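/- **Setting.** Let $\mathcal X\subseteq\mathbb R^d$ be closed and convex, $\mathcal Y$ a measurable space, $L,\rho>0$, $B:=8L^2/\rho^2$, and let $l:\mathcal X\times\mathcal Y\to[0,B]$ be measurable in its second argument. Assumption 1: for every $y\in\mathcal Y$ the function $l(\cdot,y)$ is $L$-Lipschitz on $\mathcal X$ and $\rho$-strongly convex, i.e. $x\mapsto l(x,y)-\frac{\rho^2}{2}\|x\|^2$ is convex on $\mathcal X$. Let $K\ge 1$ experts $F_1,\dots,F_K$ (with values in $\mathcal X$) and a target $Y$ (with values in $\mathcal Y$) have an arbitrary joint law $P$, and let $(F_{1,t},\dots,F_{K,t},Y_t)_{t\ge1}$ be i.i.d. with law $P$. The risk of a forecasting rule $g=g(F_1,\dots,F_K)$ is $R(g)=\mathbb E_P[l(g(F_1,\dots,F_K),Y)]$, on a fresh independent round, and $R^*=\min_{1\le i\le K}R(F_i)$. Fix $\delta\in(0,1)$. **Notation.** At most two experts are queried in each round. Let $T_i(t)$ be the number of rounds $s\le t$ in which expert $i$ is queried, $T_{ij}(t)$ the number of rounds $s\le t$ in which both $i$ and $j$ are queried (so $T_{ii}=T_i$), $\hat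 R_i(t)$ the average of $l(F_{i,s},Y_s)$ over the rounds counted by $T_i(t)$, and $\hat R_{ij}(k,t)$ (for $k\in\{i,j\}$) and $\hat d_{ij}(t)^2$ the averages of $l(F_{k,s},Y_s)$ and of $\|F_{i,s}-F_{j,s}\|^2$ over the rounds counted by $T_{ij}(t)$. Put $\delta_t=\delta/(t(t+1))$, $\alpha_{ij}(t)=\sqrt{\log(4K\delta_t^{-1})/T_{ij}(t)}$ ($=\infty$ if $T_{ij}(t)=0$), and $$\Delta'_{ij}(t)=\hat R_{ij}(j,t)-\hat R_{ij}(i,t)-6\max\{L\,\alpha_{ij}(t)\,\hat d_{ij}(t),\;B\,\alpha_{ij}(t)^2\}$$ ($=-\infty$ if $T_{ij}(t)=0$). **Algorithm 2.** Start with $S=\{1,\dots,K\}$. In round $t=1,2,\dots$ query a pair $(i,j)\in\operatorname{Arg\,Min}_{(u,v)\in S\times S}T_{uv}(t-1)$ (ties are broken arbitrarily, using only the past and possibly independent randomization), then remove from $S$ every $v$ for which $\Delta'_{uv}(t)>0$ for some $u\in\{1,\dots,K\}$. On interruption after round $T$: let $\hat k\in S$ be arbitrary, let $\hat l\in\operatorname{Arg\,Max}_{j\in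 S}\hat d_{\hat kj}(T)$, where $\hat l\ne\hat k$ unless $S=\{\hat k\}$, and let $\hat q\in\operatorname{Arg\,Min}_{j\in S}\hat R_j(T)$. The output is $\hat g=\frac12(F_{\hat k}+F_{\hat l})$ if $T_{\hat k\hat l}(T)>\sqrt{\log(KT\delta^{-1})\,T_{\hat q}(T)}$, and $\hat g=F_{\hat q}$ otherwise. **Theorem (Empirical bound).** There is an absolute constant $c>0$ such that in this setting, for every $T\ge 2K^2$, the following holds with probability at least $1-3\delta$: after round $T$ the set $S$ is nonempty, and for all admissible choices of $\hat k,\hat l,\hat q$, $$R(\hat g)\le R^*+c\,B\,\min\left\{\frac{\log(TK\delta^{-1})}{T_{\hat k\hat l}(T)},\ \sqrt{\frac{\log(TK\delta^{-1})}{T_{\hat q}(T)}}\right\}.$$ -/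

import Mathlib

open MeasureTheory ProbabilityTheory
open scoped Classical

noncomputable section

namespace TwoPointFeedback

/-- The data of one round: the advice `F_1, …, F_K` of the `K` experts (vectors of `ℝ^d`) and the
target `Y`. -/
abbrev Round (d K : ℕ) (𝒴 : Type*) := (Fin K → EuclideanSpace ℝ (Fin d)) × 𝒴

/-- The loss `l(·, y)` is `L`-Lipschitz and `ρ`-strongly convex on `X` for every `y`, where
`ρ`-strongly convex means that `x ↦ l(x, y) - (ρ² / 2) ‖x‖²` is convex. -/
def LossAssumption {d : ℕ} {𝒴 : Type*} (X : Set (EuclideanSpace ℝ (Fin d)))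
    (l : EuclideanSpace ℝ (Fin d) → 𝒴 → ℝ) (L ρ : ℝ) : Prop :=
  ∀ y : 𝒴,
    (∀ x ∈ X, ∀ x' ∈ X, |l x y - l x' y| ≤ L * ‖x - x'‖) ∧
    ConvexOn ℝ X (fun x => l x y - ρ ^ 2 / 2 * ‖x‖ ^ 2)

/-- The constant `B = 8 L² / ρ²`. -/
def lossBound (L ρ : ℝ) : ℝ := 8 * L ^ 2 / ρ ^ 2

section Risk

variable {d K : ℕ} {𝒴 : Type*} [MeasurableSpace 𝒴]

/-- The risk `R(g) = 𝔼[l(g(F_1, …, F_K), Y)]` of a rule `g` that turns the experts' advice into a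
forecast; the expectation is over a fresh round, whose law is `P`. -/
def risk (P : Measure (Round d K 𝒴)) (l : EuclideanSpace ℝ (Fin d) → 𝒴 → ℝ)
    (g : (Fin K → EuclideanSpace ℝ (Fin d)) → EuclideanSpace ℝ (Fin d)) : ℝ :=
  ∫ z, l (g z.1) z.2 ∂P

/-- The risk `R* = min_i R(F_i)` of the best expert. -/
def bestRisk (P : Measure (Round d K 𝒴)) (l : EuclideanSpace ℝ (Fin d) → 𝒴 → ℝ) : ℝ :=
  ⨅ i : Fin K, risk P l (fun f => f i)

end Risk

section Statistics

/-! Below, `p s` and `z s` are the pair of experts queried in, and the data of, the `(s+1)`-st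
round, so that `s ∈ Finset.range t` runs through the first `t` rounds. The statistics use only the
advice that was queried. -/

variable {d K : ℕ} {𝒴 : Type*}

/-- Expert `i` is queried in the round with index `s`. -/
def Queried (p : ℕ → Fin K × Fin K) (i : Fin K) (s : ℕ) : Prop :=
  (p s).1 = i ∨ (p s).2 = i

/-- The rounds, among the first `t`, in which expert `i` is queried. -/
def rounds (p : ℕ → Fin K × Fin K) (t : ℕ) (i : Fin K) : Finset ℕ :=
  (Finset.range t).filter (fun s => Queried p i s)

/-- The rounds, among the first `t`, in which experts `i` and `j` are jointly queried. -/
def jointRounds (p : ℕ → Fin K × Fin K) (t : ℕ) (i j : Fin K) : Finset ℕ :=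
  (Finset.range t).filter (fun s => Queried p i s ∧ Queried p j s)

/-- `T_i(t)`. -/
def count (p : ℕ → Fin K × Fin K) (t : ℕ) (i : Fin K) : ℕ := (rounds p t i).card

/-- `T_{ij}(t)`. -/
def jointCount (p : ℕ → Fin K × Fin K) (t : ℕ) (i j : Fin K) : ℕ := (jointRounds p t i j).card

/-- The empirical risk of expert `i` over the rounds in which it was queried. -/
def empRisk (l : EuclideanSpace ℝ (Fin d) → 𝒴 → ℝ) (p : ℕ → Fin K × Fin K)
    (z : ℕ → Round d K 𝒴) (t : ℕ) (i : Fin K) : ℝ :=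
  (∑ s ∈ rounds p t i, l ((z s).1 i) (z s).2) / (count p t i : ℝ)

/-- The empirical risk of expert `k` over the rounds in which `i` and `j` were jointly queried
(used for `k = i` and `k = j`). -/
def jointEmpRisk (l : EuclideanSpace ℝ (Fin d) → 𝒴 → ℝ) (p : ℕ → Fin K × Fin K)
    (z : ℕ → Round d K 𝒴) (t : ℕ) (i j k : Fin K) : ℝ :=
  (∑ s ∈ jointRounds p t i j, l ((z s).1 k) (z s).2) / (jointCount p t i j : ℝ)

/-- The empirical `L²` distance of experts `i` and `j` over the rounds in which they were jointly
queried. -/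
def empDist (p : ℕ → Fin K × Fin K) (z : ℕ → Round d K 𝒴) (t : ℕ) (i j : Fin K) : ℝ :=
  Real.sqrt ((∑ s ∈ jointRounds p t i j, ‖(z s).1 i - (z s).1 j‖ ^ 2) / (jointCount p t i j : ℝ))

/-- `α_{ij}(t, δ) = √(log (4 K δ⁻¹) / T_{ij}(t))`, used only when `T_{ij}(t) > 0`. -/
def alpha (p : ℕ → Fin K × Fin K) (t : ℕ) (i j : Fin K) (δ : ℝ) : ℝ :=
  Real.sqrt (Real.log (4 * (K : ℝ) * δ⁻¹) / (jointCount p t i j : ℝ))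

/-- `δ_t = δ / (t (t + 1))`. -/
def deltaRound (δ : ℝ) (t : ℕ) : ℝ := δ / ((t : ℝ) * ((t : ℝ) + 1))

/-- The test statistic `Δ'_{ij}(t, δ)`, used only when `T_{ij}(t) > 0`. -/
def testStat (l : EuclideanSpace ℝ (Fin d) → 𝒴 → ℝ) (L ρ δ : ℝ) (p : ℕ → Fin K × Fin K)
    (z : ℕ → Round d K 𝒴) (t : ℕ) (i j : Fin K) : ℝ :=
  jointEmpRisk l p z t i j j - jointEmpRisk l p z t i j i -
    6 * max (L * alpha p t i j (deltaRound δ t) * empDist p z t i j)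
      (lossBound L ρ * alpha p t i j (deltaRound δ t) ^ 2)

/-- After round `t` the test makes `u` eliminate `v`: `Δ'_{uv}(t, δ) > 0`. If `u` and `v` were
never jointly queried then `α_{uv} = ∞` and `Δ'_{uv} = -∞`, so there is no elimination. -/
def Eliminates (l : EuclideanSpace ℝ (Fin d) → 𝒴 → ℝ) (L ρ δ : ℝ) (p : ℕ → Fin K × Fin K)
    (z : ℕ → Round d K 𝒴) (t : ℕ) (u v : Fin K) : Prop :=
  0 < jointCount p t u v ∧ 0 < testStat l L ρ δ p z t u v

/-- The set `S` of experts that are not eliminated after `t` rounds. -/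
def survivors (l : EuclideanSpace ℝ (Fin d) → 𝒴 → ℝ) (L ρ δ : ℝ) (p : ℕ → Fin K × Fin K)
    (z : ℕ → Round d K 𝒴) : ℕ → Finset (Fin K)
  | 0 => Finset.univ
  | t + 1 => (survivors l L ρ δ p z t).filter (fun v => ∀ u, ¬ Eliminates l L ρ δ p z (t + 1) u v)

/-- The queries `p` are those of the algorithm on the data `z`: as long as the current set `S` of
experts is nonempty, the next pair lies in `Argmin_{(u, v) ∈ S × S} T_{uv}` (ties are broken
arbitrarily). -/
def IsRun (l : EuclideanSpace ℝ (Fin d) → 𝒴 → ℝ) (L ρ δ : ℝ) (p : ℕ → Fin K × Fin K)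
    (z : ℕ → Round d K 𝒴) : Prop :=
  ∀ t : ℕ, (survivors l L ρ δ p z t).Nonempty →
    p t ∈ survivors l L ρ δ p z t ×ˢ survivors l L ρ δ p z t ∧
    ∀ w ∈ survivors l L ρ δ p z t ×ˢ survivors l L ρ δ p z t,
      jointCount p t (p t).1 (p t).2 ≤ jointCount p t w.1 w.2

/-- `k`, `m`, `q` are possible values of the experts `k̂`, `l̂`, `q̂` that are picked when the
algorithm is interrupted after round `T`: `k̂` is any element of `S`, `l̂` maximizes `d̂_{k̂ j}` over
`j ∈ S` (with `l̂ ≠ k̂` unless `k̂` is the only element of `S`), and `q̂` minimizes the empirical risk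
over `S`. -/
structure IsSelection (l : EuclideanSpace ℝ (Fin d) → 𝒴 → ℝ) (L ρ δ : ℝ) (p : ℕ → Fin K × Fin K)
    (z : ℕ → Round d K 𝒴) (T : ℕ) (k m q : Fin K) : Prop where
  k_mem : k ∈ survivors l L ρ δ p z T
  m_mem : m ∈ survivors l L ρ δ p z T
  m_max : ∀ j ∈ survivors l L ρ δ p z T, empDist p z T k j ≤ empDist p z T k m
  m_ne : survivors l L ρ δ p z T ≠ {k} → m ≠ k
  q_mem : q ∈ survivors l L ρ δ p z T
  q_min : ∀ j ∈ survivors l L ρ δ p z T, empRisk l p z T q ≤ empRisk l p z T j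

/-- The output `ĝ` after `T` rounds, as a rule turning the experts' advice into a forecast: the
average of the experts `k` and `m` if `T_{km}(T) > √(log (K T δ⁻¹) T_q(T))`, and expert `q`
otherwise. -/
def output (δ : ℝ) (p : ℕ → Fin K × Fin K) (T : ℕ) (k m q : Fin K) :
    (Fin K → EuclideanSpace ℝ (Fin d)) → EuclideanSpace ℝ (Fin d) :=
  if Real.sqrt (Real.log ((K : ℝ) * (T : ℝ) * δ⁻¹) * (count p T q : ℝ)) < (jointCount p T k m : ℝ)
  then fun f => (1 / 2 : ℝ) • (f k + f m)
  else fun f => f q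

end Statistics

end TwoPointFeedback

end

/-! Outside an event of probability at most 3δ everything is deterministic. There are three
ingredients.

Balance. The queried pair has the least joint count among surviving pairs, so putting a survivor `x`
in place of one member of a pair costs at most one observation: `T_uv ≤ T_xv + 1` for `u ≠ v`
(`jointCount_le_add_one`). Hence the best expert has been compared with the selected experts about
as often as they have been with each other, and survivors have comparable total counts
(`count_le_three_mul_count`).

Concentration. Queries are predictable, so exponential products over the queried rounds have mean at
most one whatever the random number of queries. The inequality `exp (y - y²) ≤ 1 + y` makes the
bound self-normalized: the empirical squared distance plays the part of the variance. Loss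
differences thus deviate by at most 5 widths (`LossDiffEvent.sub_le`). As the test uses 6 widths,
the best expert is never eliminated and a survivor's excess risk is at most 6 + 5 = 11 widths.

Curvature. A width is of order `L α d̂ + B α²`, which alone gives a slow rate. Strong convexity
lowers the risk of the midpoint of `k̂` and `l̂` by `ρ²/8` times their mean squared distance. Since
`l̂` is farthest from `k̂`, that distance controls the distances of both to the best expert up to
`O(log / T)`, so by AM-GM the gain absorbs the terms `L α d̂` and leaves the fast rate
(`risk_midpoint_sub_le`).

The expert `q̂` has the slow rate by ordinary concentration (`risk_selected_sub_le`), and the output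
rule picks whichever of the two bounds is smaller. -/

namespace TwoPointFeedback

/-! ### Balance of the query counts. -/

section Combinatorics

variable {d K : ℕ} {𝒴 : Type*} {l : EuclideanSpace ℝ (Fin d) → 𝒴 → ℝ} {L ρ δ : ℝ}
  {p : ℕ → Fin K × Fin K} {z : ℕ → Round d K 𝒴}

theorem survivors_antitone : Antitone (survivors l L ρ δ p z) :=
  antitone_nat_of_succ_le fun _ => Finset.filter_subset _ _

theorem jointRounds_comm (t : ℕ) (i j : Fin K) : jointRounds p t i j = jointRounds p t j i := by
  simp only [jointRounds, and_comm]

theorem jointCount_comm (t : ℕ) (i j : Fin K) : jointCount p t i j = jointCount p t j i := by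
  rw [jointCount, jointRounds_comm, jointCount]

theorem jointRounds_self (t : ℕ) (i : Fin K) : jointRounds p t i i = rounds p t i := by
  simp only [jointRounds, rounds, and_self]

theorem jointCount_self (t : ℕ) (i : Fin K) : jointCount p t i i = count p t i := by
  rw [jointCount, jointRounds_self, count]

theorem empDist_comm (t : ℕ) (i j : Fin K) : empDist p z t i j = empDist p z t j i := by
  simp only [empDist, jointRounds_comm t i j, jointCount_comm t i j, norm_sub_rev]

theorem jointCount_succ (t : ℕ) (i j : Fin K) :
    jointCount p (t + 1) i j =
      jointCount p t i j + if Queried p i t ∧ Queried p j t then 1 else 0 := by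
  simp only [jointCount, jointRounds, Finset.range_add_one, Finset.filter_insert]
  split_ifs with h
  · rw [Finset.card_insert_of_notMem (by simp)]
  · rfl

theorem jointCount_mono (i j : Fin K) : Monotone fun t => jointCount p t i j :=
  monotone_nat_of_le_succ fun t => by simp only [jointCount_succ]; omega

theorem jointCount_le (t : ℕ) (i j : Fin K) : jointCount p t i j ≤ t := by
  simpa [jointCount, jointRounds] using
    Finset.card_filter_le (Finset.range t) fun s => Queried p i s ∧ Queried p j s

theorem count_le (t : ℕ) (i : Fin K) : count p t i ≤ t := jointCount_self (p := p) t i ▸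
  jointCount_le t i i

theorem eq_or_eq_swap_of_queried {u v : Fin K} {t : ℕ} (huv : u ≠ v) (hu : Queried p u t)
    (hv : Queried p v t) : p t = (u, v) ∨ p t = (v, u) := by
  rcases hu with hu | hu <;> rcases hv with hv | hv
  · exact absurd (hu.symm.trans hv) huv
  · exact Or.inl (Prod.ext hu hv)
  · exact Or.inr (Prod.ext hv hu)
  · exact absurd (hu.symm.trans hv) huv

/-- Replacing an expert by a survivor decreases a joint count by at most one. -/
theorem jointCount_le_add_one (hp : IsRun l L ρ δ p z) {u v : Fin K} (huv : u ≠ v) {x : Fin K}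
    (t : ℕ) (hx : x ∈ survivors l L ρ δ p z t) : jointCount p t u v ≤ jointCount p t x v + 1 := by
  induction t with
  | zero => exact (jointCount_le 0 u v).trans (Nat.zero_le _)
  | succ t ih =>
    replace hx := survivors_antitone (Nat.le_succ t) hx
    have hmono : jointCount p t x v ≤ jointCount p (t + 1) x v := jointCount_mono x v t.le_succ
    rw [jointCount_succ t u v]
    split_ifs with hq
    · obtain ⟨hmem, hmin⟩ := hp t ⟨x, hx⟩
      rw [Finset.mem_product] at hmem
      rcases eq_or_eq_swap_of_queried huv hq.1 hq.2 with h | h <;> rw [h] at hmem hmin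
      · have := hmin (x, v) (Finset.mem_product.2 ⟨hx, hmem.2⟩)
        simp only at this; omega
      · have := hmin (x, v) (Finset.mem_product.2 ⟨hx, hmem.1⟩)
        rw [jointCount_comm] at this; simp only at this; omega
    · have := ih hx; omega

/-- Pigeonhole: as long as a surviving pair has count zero, only pairs of count zero are queried, so
no pair repeats, and there are only `K ^ 2` pairs. -/
theorem jointCount_pos (hp : IsRun l L ρ δ p z) {T : ℕ} (hT : K ^ 2 < T) {x y : Fin K}
    (hx : x ∈ survivors l L ρ δ p z T) (hy : y ∈ survivors l L ρ δ p z T) :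
    0 < jointCount p T x y := by
  by_contra h0
  have hinj : Set.InjOn p (Finset.range T) := by
    have key : ∀ s t, s < t → t < T → p s ≠ p t := by
      intro s t hst htT heq
      have hxt := survivors_antitone htT.le hx
      have hyt := survivors_antitone htT.le hy
      have hmin := (hp t ⟨x, hxt⟩).2 (x, y) (Finset.mem_product.2 ⟨hxt, hyt⟩)
      have hm : jointCount p t x y ≤ jointCount p T x y := jointCount_mono x y htT.le
      have : 0 < jointCount p t (p t).1 (p t).2 := by
        refine Finset.card_pos.2 ⟨s, ?_⟩
        simp only [jointRounds, Finset.mem_filter, Finset.mem_range]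
        exact ⟨hst, Or.inl (by rw [heq]), Or.inr (by rw [heq])⟩
      simp only at hmin
      omega
    intro s hs t ht heq
    simp only [Finset.coe_range, Set.mem_Iio] at hs ht
    rcases lt_trichotomy s t with h | h | h
    · exact absurd heq (key s t h ht)
    · exact h
    · exact absurd heq.symm (key t s h hs)
  have hcard := Finset.card_le_card_of_injOn p (fun s _ => Finset.mem_univ (p s)) hinj
  simp only [Finset.card_range, Finset.card_univ, Fintype.card_prod, Fintype.card_fin] at hcard
  nlinarith

theorem exists_eliminates_of_notMem_survivors {T : ℕ} {v : Fin K}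
    (hv : v ∉ survivors l L ρ δ p z T) :
    ∃ t, t < T ∧ ∃ u, Eliminates l L ρ δ p z (t + 1) u v := by
  induction T with
  | zero => simp [survivors] at hv
  | succ T ih =>
    by_cases h : v ∈ survivors l L ρ δ p z T
    · simp only [survivors, Finset.mem_filter, h, true_and, not_forall, not_not] at hv
      exact ⟨T, Nat.lt_succ_self T, hv⟩
    · obtain ⟨t, ht, hu⟩ := ih h
      exact ⟨t, ht.trans (Nat.lt_succ_self T), hu⟩

theorem sum_jointCount_le_count (t : ℕ) (i : Fin K) :
    ∑ v ∈ Finset.univ.erase i, jointCount p t i v ≤ count p t i := by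
  simp only [jointCount, count]
  rw [← Finset.card_biUnion]
  · refine Finset.card_le_card ?_
    intro s hs
    simp only [Finset.mem_biUnion, jointRounds, Finset.mem_filter] at hs
    obtain ⟨v, -, hs, hi, -⟩ := hs
    exact Finset.mem_filter.2 ⟨hs, hi⟩
  · intro u hu v hv huv
    refine Finset.disjoint_left.2 fun s hs hs' => ?_
    simp only [jointRounds, Finset.mem_filter] at hs hs'
    have hu' : i ≠ u := by simpa [eq_comm] using hu
    have hv' : i ≠ v := by simpa [eq_comm] using hv
    have h1 := eq_or_eq_swap_of_queried hu' hs.2.1 hs.2.2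
    have h2 := eq_or_eq_swap_of_queried hv' hs'.2.1 hs'.2.2
    rcases h1 with h1 | h1 <;> rcases h2 with h2 | h2 <;>
      simp only [h1, Prod.mk.injEq] at h2 <;> grind

/-- The rounds in which an expert that survives together with another one is queried alone. -/
theorem card_solo_le_one (hp : IsRun l L ρ δ p z) {T : ℕ} {q i : Fin K} (hqi : q ≠ i)
    (hq : q ∈ survivors l L ρ δ p z T) (hi : i ∈ survivors l L ρ δ p z T) :
    ((Finset.range T).filter fun s => p s = (q, q)).card ≤ 1 := by
  -- A solo query adds to `T_qq` but not to `T_qi`, so afterwards `(q, i)` always has the smaller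
  -- count.
  have key : ∀ s t, s < t → t < T → p s = (q, q) → p t = (q, q) → False := by
    intro s t hst htT hs ht
    have hqt := survivors_antitone htT.le hq
    have hit := survivors_antitone htT.le hi
    have hmin := (hp t ⟨q, hqt⟩).2 (q, i) (Finset.mem_product.2 ⟨hqt, hit⟩)
    rw [ht] at hmin
    simp only [jointCount] at hmin
    have hlt : (jointRounds p t q i).card < (jointRounds p t q q).card := by
      refine Finset.card_lt_card ((Finset.ssubset_iff_of_subset ?_).2 ⟨s, ?_, ?_⟩)
      · intro r hr
        simp only [jointRounds, Finset.mem_filter] at hr ⊢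
        exact ⟨hr.1, hr.2.1, hr.2.1⟩
      · simp [jointRounds, Queried, hs, hst]
      · intro h
        have h' := (Finset.mem_filter.1 h).2.2
        simp only [Queried, hs] at h'
        tauto
    omega
  refine Finset.card_le_one.2 fun s hs t ht => ?_
  simp only [Finset.mem_filter, Finset.mem_range] at hs ht
  rcases lt_trichotomy s t with h | h | h
  · exact (key s t h ht.1 hs.2 ht.2).elim
  · exact h
  · exact (key t s h hs.1 ht.2 hs.2).elim

theorem count_le_solo_add_sum (t : ℕ) (q : Fin K) :
    count p t q ≤ ((Finset.range t).filter fun s => p s = (q, q)).card +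
      ∑ v ∈ Finset.univ.erase q, jointCount p t q v := by
  have hsub : rounds p t q ⊆ ((Finset.range t).filter fun s => p s = (q, q)) ∪
      (Finset.univ.erase q).biUnion fun v => jointRounds p t q v := by
    intro s hs
    simp only [rounds, Finset.mem_filter, Finset.mem_range] at hs
    simp only [jointRounds, Finset.mem_union, Finset.mem_biUnion, Finset.mem_filter,
      Finset.mem_range, Finset.mem_erase, Finset.mem_univ, and_true]
    by_cases h1 : (p s).1 = q
    · by_cases h2 : (p s).2 = q
      · exact Or.inl ⟨hs.1, Prod.ext h1 h2⟩
      · exact Or.inr ⟨(p s).2, h2, hs.1, hs.2, Or.inr rfl⟩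
    · exact Or.inr ⟨(p s).1, h1, hs.1, hs.2, Or.inl rfl⟩
  calc count p t q ≤ _ := Finset.card_le_card hsub
    _ ≤ _ := Finset.card_union_le _ _
    _ ≤ _ := Nat.add_le_add_left Finset.card_biUnion_le _

/-- Two experts that survive have been queried comparably often. -/
theorem count_le_three_mul_count (hp : IsRun l L ρ δ p z) {T : ℕ} (hT : K ^ 2 < T)
    (helim : ∀ t < T, ∀ u v, Eliminates l L ρ δ p z (t + 1) u v →
      u ≠ v ∧ 2 ≤ jointCount p (t + 1) u v)
    {q i : Fin K} (hq : q ∈ survivors l L ρ δ p z T) (hi : i ∈ survivors l L ρ δ p z T) :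
    count p T q ≤ 3 * count p T i := by
  rcases eq_or_ne q i with rfl | hqi
  · omega
  -- An eliminated `v` had been observed at least twice with its eliminator; balance leaves at least
  -- one observation with `i`. This is what absorbs the additive one of the balance inequality into
  -- a factor 2.
  have hpos : ∀ v, v ≠ i → 1 ≤ jointCount p T i v := by
    intro v hvi
    by_cases hv : v ∈ survivors l L ρ δ p z T
    · exact jointCount_pos hp hT hi hv
    · obtain ⟨t, htT, u, hu⟩ := exists_eliminates_of_notMem_survivors hv
      obtain ⟨huv, h2⟩ := helim t htT u v hu
      have hm : jointCount p (t + 1) i v ≤ jointCount p T i v := jointCount_mono i v htT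
      have := jointCount_le_add_one hp huv (t + 1) (survivors_antitone (Nat.succ_le_of_lt htT) hi)
      omega
  have hle : ∀ v ∈ (Finset.univ.erase q).erase i, jointCount p T q v ≤ 2 * jointCount p T i v := by
    intro v hv
    simp only [Finset.mem_erase] at hv
    have := jointCount_le_add_one hp hv.2.1.symm T hi
    have := hpos v hv.1
    omega
  have hiq : i ∈ Finset.univ.erase q := by simp [hqi.symm]
  have hqi' : q ∈ Finset.univ.erase i := by simp [hqi]
  have h1 := count_le_solo_add_sum (p := p) T q
  have h2 := card_solo_le_one hp hqi hq hi
  have h3 := sum_jointCount_le_count (p := p) T i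
  rw [← Finset.add_sum_erase _ _ hiq] at h1
  rw [← Finset.add_sum_erase _ _ hqi', Finset.erase_right_comm] at h3
  have h4 := Finset.sum_le_sum hle
  rw [← Finset.mul_sum] at h4
  rw [jointCount_comm T i q] at h3
  have h5 := jointCount_pos hp hT hq hi
  omega

end Combinatorics

/-! ### Exponential inequalities under predictable sampling. -/

section Concentration

variable {E Ω : Type*} [MeasurableSpace E] {P : Measure E} {mΩ : MeasurableSpace Ω}
  {μ : Measure Ω} {ℱ : Filtration ℕ mΩ} {Z : ℕ → Ω → E} {A : ℕ → Set Ω}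

open scoped ENNReal

theorem measurable_prod_predictable (hZ : ∀ t, Measurable[ℱ (t + 1)] (Z t))
    (hA : ∀ s, MeasurableSet[ℱ s] (A s)) {φ : E → ℝ≥0∞} (hφ : Measurable φ) (t : ℕ) :
    Measurable[ℱ t] fun ω => ∏ s ∈ Finset.range t, if ω ∈ A s then φ (Z s ω) else 1 := by
  refine Finset.measurable_fun_prod _ fun s hs => ?_
  have hst : s + 1 ≤ t := Finset.mem_range.1 hs
  refine Measurable.ite (ℱ.mono (s.le_succ.trans hst) _ (hA s)) ?_ measurable_const
  exact hφ.comp ((hZ s).mono (ℱ.mono hst) le_rfl)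

/-- Products over predictably chosen rounds of a factor of mean at most one. -/
theorem lintegral_prod_predictable_le_one [IsProbabilityMeasure μ]
    (hZ : ∀ t, Measurable[ℱ (t + 1)] (Z t)) (hmap : ∀ t, μ.map (Z t) = P)
    (hind : ∀ t, Indep (MeasurableSpace.comap (Z t) inferInstance) (ℱ t) μ)
    (hA : ∀ s, MeasurableSet[ℱ s] (A s)) {φ : E → ℝ≥0∞} (hφ : Measurable φ)
    (hφ1 : ∫⁻ z, φ z ∂P ≤ 1) (t : ℕ) :
    ∫⁻ ω, ∏ s ∈ Finset.range t, (if ω ∈ A s then φ (Z s ω) else 1) ∂μ ≤ 1 := by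
  induction t with
  | zero => simp
  | succ t ih =>
    set M : Ω → ℝ≥0∞ := fun ω => ∏ s ∈ Finset.range t, if ω ∈ A s then φ (Z s ω) else 1
    have hM : Measurable[ℱ t] M := measurable_prod_predictable hZ hA hφ t
    have hZt : Measurable (Z t) := (hZ t).mono (ℱ.le _) le_rfl
    -- Off `A t` the product is unchanged; on `A t` it gains a factor independent of `ℱ t` with mean
    -- at most one.
    have hsplit : ∀ ω, ∏ s ∈ Finset.range (t + 1), (if ω ∈ A s then φ (Z s ω) else 1) =
        φ (Z t ω) * (A t).indicator M ω + (A t)ᶜ.indicator M ω := by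
      intro ω
      rw [Finset.prod_range_succ]
      by_cases h : ω ∈ A t <;> simp [h, M, mul_comm]
    have hAM : Measurable[ℱ t] ((A t).indicator M) := hM.indicator (hA t)
    simp_rw [hsplit]
    have hmul : Measurable fun ω => φ (Z t ω) * (A t).indicator M ω :=
      (hφ.comp hZt).mul (hAM.mono (ℱ.le t) le_rfl)
    rw [lintegral_add_left hmul,
      lintegral_mul_eq_lintegral_mul_lintegral_of_independent_measurableSpace
        (f := fun ω => φ (Z t ω))
        (measurable_iff_comap_le.1 hZt) (ℱ.le t) (hind t)
        (hφ.comp (Measurable.of_comap_le le_rfl)) hAM]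
    have h1 : ∫⁻ ω, φ (Z t ω) ∂μ ≤ 1 := by
      rwa [← hmap t, lintegral_map hφ hZt] at hφ1
    calc _ ≤ ∫⁻ ω, (A t).indicator M ω ∂μ + ∫⁻ ω, (A t)ᶜ.indicator M ω ∂μ := by
          gcongr
          exact mul_le_of_le_one_left (by positivity) h1
      _ = ∫⁻ ω, M ω ∂μ := by
          rw [lintegral_indicator (ℱ.le t _ (hA t)), lintegral_indicator (ℱ.le t _ (hA t)).compl,
            lintegral_add_compl _ (ℱ.le t _ (hA t))]
      _ ≤ 1 := ih

/-- Chernoff bound for sums over predictably chosen rounds. -/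
theorem measure_lt_sum_predictable_le [IsProbabilityMeasure μ]
    (hZ : ∀ t, Measurable[ℱ (t + 1)] (Z t)) (hmap : ∀ t, μ.map (Z t) = P)
    (hind : ∀ t, Indep (MeasurableSpace.comap (Z t) inferInstance) (ℱ t) μ)
    (hA : ∀ s, MeasurableSet[ℱ s] (A s)) {ψ : E → ℝ} (hψ : Measurable ψ)
    (hψ1 : ∫⁻ z, ENNReal.ofReal (Real.exp (ψ z)) ∂P ≤ 1) (t : ℕ) (x : ℝ) :
    μ {ω | x < ∑ s ∈ (Finset.range t).filter (fun s => ω ∈ A s), ψ (Z s ω)} ≤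
      ENNReal.ofReal (Real.exp (-x)) := by
  have hφ : Measurable fun z => ENNReal.ofReal (Real.exp (ψ z)) := by fun_prop
  have hle := lintegral_prod_predictable_le_one hZ hmap hind hA hφ hψ1 t
  have hmeas := (measurable_prod_predictable hZ hA hφ t).mono (ℱ.le t) le_rfl
  have hmarkov := mul_meas_ge_le_lintegral (μ := μ) hmeas (ENNReal.ofReal (Real.exp x))
  have hx : ENNReal.ofReal (Real.exp (-x)) * ENNReal.ofReal (Real.exp x) = 1 := by
    rw [← ENNReal.ofReal_mul (Real.exp_pos _).le, ← Real.exp_add]; simp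
  have hsub : {ω | x < ∑ s ∈ (Finset.range t).filter (fun s => ω ∈ A s), ψ (Z s ω)} ⊆
      {ω | ENNReal.ofReal (Real.exp x) ≤ ∏ s ∈ Finset.range t,
        if ω ∈ A s then ENNReal.ofReal (Real.exp (ψ (Z s ω))) else 1} := by
    intro ω hω
    simp only [Set.mem_ofPred_eq] at hω ⊢
    rw [← Finset.prod_filter, ← ENNReal.ofReal_prod_of_nonneg fun _ _ => (Real.exp_pos _).le,
      ← Real.exp_sum]
    exact ENNReal.ofReal_le_ofReal (Real.exp_le_exp.2 hω.le)
  calc _ ≤ _ := measure_mono hsub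
    _ = ENNReal.ofReal (Real.exp (-x)) * (ENNReal.ofReal (Real.exp x) * μ _) := by
        rw [← mul_assoc, hx, one_mul]
    _ ≤ ENNReal.ofReal (Real.exp (-x)) * 1 := by
        gcongr
        exact hmarkov.trans hle
    _ = _ := mul_one _

/-- Integrating the hypothesis and using `1 + m ≤ exp m` with `m` the mean of `Y`. The pointwise
inequality is the only input that changes from one tail bound to another. -/
theorem lintegral_exp_sub_integral_le_one [IsProbabilityMeasure P] {ψ Y : E → ℝ}
    (hY : Integrable Y P) (h : ∀ᵐ z ∂P, Real.exp (ψ z) ≤ 1 + Y z) :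
    ∫⁻ z, ENNReal.ofReal (Real.exp (ψ z - ∫ w, Y w ∂P)) ∂P ≤ 1 := by
  set m := ∫ w, Y w ∂P
  have hint : Integrable (fun z => Real.exp (-m) * (1 + Y z)) P :=
    ((integrable_const 1).add hY).const_mul _
  have hae : ∀ᵐ z ∂P, Real.exp (ψ z - m) ≤ Real.exp (-m) * (1 + Y z) := by
    filter_upwards [h] with z hz
    rw [sub_eq_neg_add, Real.exp_add]
    gcongr
  calc _ ≤ ∫⁻ z, ENNReal.ofReal (Real.exp (-m) * (1 + Y z)) ∂P :=
        lintegral_mono_ae (hae.mono fun z hz => ENNReal.ofReal_le_ofReal hz)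
    _ = ENNReal.ofReal (∫ z, Real.exp (-m) * (1 + Y z) ∂P) :=
        (ofReal_integral_eq_lintegral_ofReal hint
          (hae.mono fun z hz => (Real.exp_pos _).le.trans hz)).symm
    _ ≤ 1 := by
        rw [integral_const_mul, integral_add (integrable_const 1) hY, integral_const]
        simp only [probReal_univ, smul_eq_mul, mul_one]
        refine ENNReal.ofReal_le_one.2 ?_
        calc _ ≤ Real.exp (-m) * Real.exp m := by
              gcongr
              linarith [Real.add_one_le_exp m]
          _ = 1 := by rw [← Real.exp_add]; simp

/-- Tail bound for a compensated sum over predictably chosen rounds. -/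
theorem measure_lt_sum_sub_integral_le [IsProbabilityMeasure μ] [IsProbabilityMeasure P]
    (hZ : ∀ t, Measurable[ℱ (t + 1)] (Z t)) (hmap : ∀ t, μ.map (Z t) = P)
    (hind : ∀ t, Indep (MeasurableSpace.comap (Z t) inferInstance) (ℱ t) μ)
    (hA : ∀ s, MeasurableSet[ℱ s] (A s)) {ψ Y : E → ℝ} (hψ : AEMeasurable ψ P)
    (hY : Integrable Y P) (h : ∀ᵐ z ∂P, Real.exp (ψ z) ≤ 1 + Y z) (t : ℕ) (x : ℝ) :
    μ {ω | x < ∑ s ∈ (Finset.range t).filter (fun s => ω ∈ A s), (ψ (Z s ω) - ∫ w, Y w ∂P)} ≤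
      ENNReal.ofReal (Real.exp (-x)) := by
  -- The loss is measurable only after a modification off `X`, hence the passage through an a.e.
  -- equal measurable version.
  obtain ⟨ψ', hψ', heq⟩ := hψ
  have hψ1 : ∀ᵐ z ∂P, Real.exp (ψ' z) ≤ 1 + Y z := by
    filter_upwards [h, heq] with z hz hz'
    rwa [← hz']
  have hae : ∀ᵐ ω ∂μ, ∀ s, ψ (Z s ω) = ψ' (Z s ω) := by
    refine ae_all_iff.2 fun s => ?_
    rw [← hmap s] at heq
    exact ae_of_ae_map ((hZ s).mono (ℱ.le _) le_rfl).aemeasurable heq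
  refine (measure_mono_ae ?_).trans (measure_lt_sum_predictable_le hZ hmap hind hA
    (hψ'.sub_const _) (lintegral_exp_sub_integral_le_one hY hψ1) t x)
  filter_upwards [hae] with ω hω hlt
  change x < _ at hlt
  change x < _
  simpa only [hω] using hlt

/-- The compensator is the observed square rather than the variance, which makes the resulting
Bernstein bound empirical. -/
theorem exp_sub_sq_le {y : ℝ} (hy : |y| ≤ 1 / 4) : Real.exp (y - y ^ 2) ≤ 1 + y := by
  obtain ⟨h1, h2⟩ := abs_le.1 hy
  have hw : 0 < 1 + (y ^ 2 - y) / 2 := by nlinarith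
  -- The exponent is halved and the bound squared because `exp u ≥ 1 + u` alone gives `(1 + y)(1 - y
  -- + y²) = 1 + y³`, too little for `y < 0`.
  have h3 : 1 + (y ^ 2 - y) / 2 ≤ Real.exp ((y ^ 2 - y) / 2) := by
    linarith [Real.add_one_le_exp ((y ^ 2 - y) / 2)]
  have h4 : (1 + (y ^ 2 - y) / 2) ^ 2 ≤ Real.exp (y ^ 2 - y) := by
    calc _ ≤ Real.exp ((y ^ 2 - y) / 2) ^ 2 := by gcongr
      _ = _ := by rw [← Real.exp_nat_mul]; congr 1; push_cast; ring
  have h5 : 1 ≤ (1 + y) * (1 + (y ^ 2 - y) / 2) ^ 2 := by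
    have : (1 + y) * (1 + (y ^ 2 - y) / 2) ^ 2 - 1 =
        y ^ 2 * (1 / 4 + 3 / 4 * y - y ^ 2 / 4 + y ^ 3 / 4) := by ring
    have h6 : 0 ≤ 1 / 4 + 3 / 4 * y - y ^ 2 / 4 + y ^ 3 / 4 := by
      nlinarith [mul_nonneg (by linarith : (0 : ℝ) ≤ 1 / 4 + y) (by linarith : (0 : ℝ) ≤ 1 / 4 - y),
        mul_nonneg (sq_nonneg y) (by linarith : (0 : ℝ) ≤ 1 / 4 + y)]
    nlinarith [mul_nonneg (sq_nonneg y) h6]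
  have h7 : 1 ≤ (1 + y) * Real.exp (y ^ 2 - y) :=
    h5.trans (mul_le_mul_of_nonneg_left h4 (by linarith))
  calc Real.exp (y - y ^ 2) = Real.exp (y - y ^ 2) * 1 := (mul_one _).symm
    _ ≤ Real.exp (y - y ^ 2) * ((1 + y) * Real.exp (y ^ 2 - y)) := by gcongr
    _ = (1 + y) * (Real.exp (y - y ^ 2) * Real.exp (y ^ 2 - y)) := by ring
    _ = 1 + y := by rw [← Real.exp_add]; simp

/-- With the next inequality, this yields multiplicative Chernoff bounds: empirical and mean squared
distances agree up to a factor 2 and an error of order `1 / n`. -/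
theorem exp_neg_le_of_mem_Icc {v : ℝ} (h0 : 0 ≤ v) (h1 : v ≤ 1) : Real.exp (-v) ≤ 1 - v / 2 := by
  have h := Real.add_one_le_exp v
  have h2 : 1 ≤ (1 - v / 2) * Real.exp v := by nlinarith
  calc Real.exp (-v) = Real.exp (-v) * 1 := (mul_one _).symm
    _ ≤ Real.exp (-v) * ((1 - v / 2) * Real.exp v) := by gcongr
    _ = (1 - v / 2) * (Real.exp (-v) * Real.exp v) := by ring
    _ = 1 - v / 2 := by rw [← Real.exp_add]; simp

theorem exp_le_one_add_two_mul {v : ℝ} (h0 : 0 ≤ v) (h1 : v ≤ 1) : Real.exp v ≤ 1 + 2 * v := by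
  have h := convexOn_exp.2 (Set.mem_univ 0) (Set.mem_univ 1) (sub_nonneg.2 h1) h0 (by ring)
  simp only [smul_eq_mul, mul_zero, mul_one, zero_add, Real.exp_zero] at h
  nlinarith [Real.exp_one_lt_three]

end Concentration

/-! ### Consequences of strong convexity, and measurability of the loss. -/

section Loss

variable {d K : ℕ} {𝒴 : Type*} {X : Set (EuclideanSpace ℝ (Fin d))}
  {l : EuclideanSpace ℝ (Fin d) → 𝒴 → ℝ} {L ρ : ℝ}

theorem LossAssumption.midpoint_le (h : LossAssumption X l L ρ) {x x' : EuclideanSpace ℝ (Fin d)}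
    (hx : x ∈ X) (hx' : x' ∈ X) (y : 𝒴) :
    l ((1 / 2 : ℝ) • (x + x')) y ≤ (l x y + l x' y) / 2 - ρ ^ 2 / 8 * ‖x - x'‖ ^ 2 := by
  have hc := (h y).2.2 hx hx' (by norm_num : (0 : ℝ) ≤ 1 / 2) (by norm_num : (0 : ℝ) ≤ 1 / 2)
    (by norm_num)
  simp only [smul_eq_mul, ← smul_add] at hc
  have hn : ‖(1 / 2 : ℝ) • (x + x')‖ ^ 2 = ‖x + x'‖ ^ 2 / 4 := by
    rw [norm_smul, mul_pow]; norm_num; ring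
  have hpar := parallelogram_law_with_norm ℝ x x'
  have h2 : ‖x + x'‖ ^ 2 = 2 * ‖x‖ ^ 2 + 2 * ‖x'‖ ^ 2 - ‖x - x'‖ ^ 2 := by nlinarith
  rw [hn, h2] at hc
  linarith

theorem lossBound_pos (hL : 0 < L) (hρ : 0 < ρ) : 0 < lossBound L ρ := by
  unfold lossBound; positivity

/-- At the midpoint the loss drops by at least `ρ² / 8 * ‖x - x'‖²` below the endpoint average,
while the Lipschitz property allows at most `L * ‖x - x'‖ / 2`. -/
theorem LossAssumption.norm_sub_le (h : LossAssumption X l L ρ) (hX : Convex ℝ X) (hρ : 0 < ρ)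
    [Nonempty 𝒴] {x x' : EuclideanSpace ℝ (Fin d)} (hx : x ∈ X) (hx' : x' ∈ X) (hL : 0 < L) :
    ‖x - x'‖ ≤ 4 * L / ρ ^ 2 := by
  obtain ⟨y⟩ := ‹Nonempty 𝒴›
  have hmid := h.midpoint_le hx hx' y
  have hm : (1 / 2 : ℝ) • (x + x') ∈ X := by
    rw [smul_add]; exact hX hx hx' (by norm_num) (by norm_num) (by norm_num)
  have e1 : x - (1 / 2 : ℝ) • (x + x') = (1 / 2 : ℝ) • (x - x') := by module
  have e2 : x' - (1 / 2 : ℝ) • (x + x') = (1 / 2 : ℝ) • (x' - x) := by module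
  have h1 := (le_abs_self _).trans ((h y).1 x hx _ hm)
  have h2 := (le_abs_self _).trans ((h y).1 x' hx' _ hm)
  rw [e1, norm_smul] at h1
  rw [e2, norm_smul, norm_sub_rev] at h2
  norm_num at h1 h2
  rw [le_div_iff₀ (by positivity)]
  by_contra hlt
  push Not at hlt
  have hpos : 0 < ‖x - x'‖ := by
    by_contra h0
    have : ‖x - x'‖ = 0 := le_antisymm (not_lt.1 h0) (norm_nonneg _)
    rw [this] at hlt; linarith
  norm_num at hmid
  nlinarith

/-- On `X` the loss is a Carathéodory function, hence jointly measurable; a measurable map sending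
the complement of `X` to one point extends it. -/
theorem exists_measurable_loss [MeasurableSpace 𝒴] (hXc : IsClosed X) (hXne : X.Nonempty)
    (hmeas : ∀ x ∈ X, Measurable (l x)) (h : LossAssumption X l L ρ) :
    ∃ l' : EuclideanSpace ℝ (Fin d) → 𝒴 → ℝ, Measurable (Function.uncurry l') ∧
      ∀ x ∈ X, ∀ y, l' x y = l x y := by
  obtain ⟨x0, hx0⟩ := hXne
  let r : EuclideanSpace ℝ (Fin d) → X := fun x => if hx : x ∈ X then ⟨x, hx⟩ else ⟨x0, hx0⟩
  have hr : Measurable r := Measurable.dite measurable_id measurable_const hXc.measurableSet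
  have hu : Measurable (Function.uncurry fun (x : X) (y : 𝒴) => l x y) := by
    refine measurable_uncurry_of_continuous_of_measurable (fun y => ?_) fun x => hmeas x x.2
    refine (LipschitzWith.of_dist_le_mul (K := L.toNNReal) fun a b => ?_).continuous
    rw [Real.dist_eq, Subtype.dist_eq, dist_eq_norm]
    exact ((h y).1 a a.2 b b.2).trans
      (mul_le_mul_of_nonneg_right (Real.le_coe_toNNReal L) (norm_nonneg _))
  refine ⟨fun x y => l (r x) y, hu.comp ((hr.comp measurable_fst).prodMk measurable_snd), ?_⟩
  intro x hx y
  simp [r, hx]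

variable [MeasurableSpace 𝒴]

/-- The mean squared distance of two experts. -/
noncomputable def sqDist (P : Measure (Round d K 𝒴)) (i j : Fin K) : ℝ :=
  ∫ z, ‖z.1 i - z.1 j‖ ^ 2 ∂P

theorem measurable_norm_sub_sq (i j : Fin K) :
    Measurable fun z : Round d K 𝒴 => ‖z.1 i - z.1 j‖ ^ 2 := by
  have h1 : ∀ i, Measurable fun z : Round d K 𝒴 => z.1 i :=
    fun i => (measurable_pi_apply i).comp measurable_fst
  exact (((h1 i).sub (h1 j)).norm).pow_const 2

variable {P : Measure (Round d K 𝒴)}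

theorem integrable_loss [IsProbabilityMeasure P] {B : ℝ} {l' : EuclideanSpace ℝ (Fin d) → 𝒴 → ℝ}
    (hl' : Measurable (Function.uncurry l')) (heq : ∀ x ∈ X, ∀ y, l' x y = l x y)
    (hB : ∀ x ∈ X, ∀ y, l x y ∈ Set.Icc 0 B)
    {g : (Fin K → EuclideanSpace ℝ (Fin d)) → EuclideanSpace ℝ (Fin d)} (hg : Measurable g)
    (hgX : ∀ᵐ z ∂P, g z.1 ∈ X) : Integrable (fun z => l (g z.1) z.2) P := by
  have h1 : Measurable fun z : Round d K 𝒴 => l' (g z.1) z.2 :=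
    hl'.comp ((hg.comp measurable_fst).prodMk measurable_snd)
  have h2 : (fun z : Round d K 𝒴 => l' (g z.1) z.2) =ᵐ[P] fun z => l (g z.1) z.2 :=
    hgX.mono fun z hz => heq _ hz _
  refine Integrable.of_bound (h1.aestronglyMeasurable.congr h2) B (hgX.mono fun z hz => ?_)
  rw [Real.norm_eq_abs, abs_of_nonneg (hB _ hz _).1]
  exact (hB _ hz _).2

theorem integrable_norm_sub_sq [IsProbabilityMeasure P] (hX : Convex ℝ X) (hL : 0 < L)
    (hρ : 0 < ρ) (hPX : ∀ᵐ z ∂P, ∀ i, z.1 i ∈ X) (h : LossAssumption X l L ρ) (i j : Fin K) :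
    Integrable (fun z => ‖z.1 i - z.1 j‖ ^ 2) P := by
  refine Integrable.of_bound (measurable_norm_sub_sq i j).aestronglyMeasurable
    ((4 * L / ρ ^ 2) ^ 2) (hPX.mono fun z hz => ?_)
  have : Nonempty 𝒴 := ⟨z.2⟩
  rw [norm_pow, norm_norm]
  exact pow_le_pow_left₀ (norm_nonneg _) (h.norm_sub_le hX hρ (hz i) (hz j) hL) 2

theorem sqDist_le [IsProbabilityMeasure P] (hX : Convex ℝ X) (hL : 0 < L)
    (hρ : 0 < ρ) (hPX : ∀ᵐ z ∂P, ∀ i, z.1 i ∈ X) (h : LossAssumption X l L ρ) (i j k : Fin K) :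
    sqDist P i k ≤ 2 * sqDist P i j + 2 * sqDist P j k := by
  have hi := fun a b => integrable_norm_sub_sq hX hL hρ hPX h a b
  unfold sqDist
  rw [← integral_const_mul, ← integral_const_mul,
    ← integral_add ((hi i j).const_mul 2) ((hi j k).const_mul 2)]
  refine integral_mono (hi i k) (((hi i j).const_mul 2).add ((hi j k).const_mul 2)) fun z => ?_
  have h1 := norm_sub_le_norm_sub_add_norm_sub (z.1 i) (z.1 j) (z.1 k)
  have h2 := norm_nonneg (z.1 i - z.1 k)
  simp only
  nlinarith [sq_nonneg (‖z.1 i - z.1 j‖ - ‖z.1 j - z.1 k‖)]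

theorem risk_midpoint_le [IsProbabilityMeasure P] (hXc : IsClosed X) (hX : Convex ℝ X)
    (hL : 0 < L) (hρ : 0 < ρ) (hmeas : ∀ x ∈ X, Measurable (l x))
    (h : LossAssumption X l L ρ) (hB : ∀ x ∈ X, ∀ y, l x y ∈ Set.Icc 0 (lossBound L ρ))
    (hPX : ∀ᵐ z ∂P, ∀ i, z.1 i ∈ X) (i j : Fin K) :
    risk P l (fun f => (1 / 2 : ℝ) • (f i + f j)) ≤
      (risk P l (fun f => f i) + risk P l (fun f => f j)) / 2 - ρ ^ 2 / 8 * sqDist P i j := by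
  obtain ⟨z, hz⟩ := hPX.exists
  obtain ⟨l', hl', heq⟩ := exists_measurable_loss hXc ⟨_, hz i⟩ hmeas h
  have hii := integrable_loss hl' heq hB (measurable_pi_apply i) (hPX.mono fun z hz => hz i)
  have hij := integrable_loss hl' heq hB (measurable_pi_apply j) (hPX.mono fun z hz => hz j)
  have hsq := integrable_norm_sub_sq hX hL hρ hPX h i j
  have hm : Integrable (fun z : Round d K 𝒴 => l ((1 / 2 : ℝ) • (z.1 i + z.1 j)) z.2) P := by
    refine integrable_loss (g := fun f => (1 / 2 : ℝ) • (f i + f j)) hl' heq hB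
      (by fun_prop)
      (hPX.mono fun z hz => ?_)
    rw [smul_add]; exact hX (hz i) (hz j) (by norm_num) (by norm_num) (by norm_num)
  have hs : Integrable (fun z : Round d K 𝒴 => (l (z.1 i) z.2 + l (z.1 j) z.2) / 2) P :=
    (hii.add hij).div_const 2
  unfold risk sqDist
  rw [← integral_add hii hij, ← integral_div, ← integral_const_mul,
    ← integral_sub hs (hsq.const_mul _)]
  refine integral_mono_ae hm (hs.sub (hsq.const_mul _))
    (hPX.mono fun z hz => ?_)
  exact h.midpoint_le (hz i) (hz j) z.2

end Loss

/-! ### Tail bounds for the statistics of the algorithm. -/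

section Events

variable {d K : ℕ} {𝒴 Ω : Type*} [MeasurableSpace 𝒴] {X : Set (EuclideanSpace ℝ (Fin d))}
  {l : EuclideanSpace ℝ (Fin d) → 𝒴 → ℝ} {L ρ δ : ℝ} {P : Measure (Round d K 𝒴)}
  {mΩ : MeasurableSpace Ω} {μ : Measure Ω} {ℱ : Filtration ℕ mΩ} {Z : ℕ → Ω → Round d K 𝒴}
  {p : ℕ → Ω → Fin K × Fin K}

/-- The assumptions on the domain, the loss and the law of a round. -/
structure Setting (X : Set (EuclideanSpace ℝ (Fin d))) (l : EuclideanSpace ℝ (Fin d) → 𝒴 → ℝ)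
    (L ρ : ℝ) (P : Measure (Round d K 𝒴)) : Prop where
  isClosed : IsClosed X
  convex : Convex ℝ X
  L_pos : 0 < L
  ρ_pos : 0 < ρ
  measurable_loss : ∀ x ∈ X, Measurable (l x)
  loss : LossAssumption X l L ρ
  mem_Icc : ∀ x ∈ X, ∀ y, l x y ∈ Set.Icc 0 (lossBound L ρ)
  ae_mem : ∀ᵐ z ∂P, ∀ i, z.1 i ∈ X

/-- The assumptions on the sequence of rounds and the adaptive queries. -/
structure Sampling (P : Measure (Round d K 𝒴)) (μ : Measure Ω) (ℱ : Filtration ℕ mΩ)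
    (Z : ℕ → Ω → Round d K 𝒴) (p : ℕ → Ω → Fin K × Fin K) : Prop where
  measurable : ∀ t, Measurable[ℱ (t + 1)] (Z t)
  map_eq : ∀ t, Measure.map (Z t) μ = P
  indep : ∀ t, Indep (MeasurableSpace.comap (Z t) inferInstance) (ℱ t) μ
  measurable_query : ∀ t, Measurable[ℱ t] (p t)

theorem Sampling.measure_lt_sum_jointRounds_le [IsProbabilityMeasure μ] [IsProbabilityMeasure P]
    (hS : Sampling P μ ℱ Z p) {ψ Y : Round d K 𝒴 → ℝ} (hψ : AEMeasurable ψ P)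
    (hY : Integrable Y P) (h : ∀ᵐ z ∂P, Real.exp (ψ z) ≤ 1 + Y z) {c : ℝ} (hc : ∫ z, Y z ∂P = c)
    (t : ℕ) (i j : Fin K) (x : ℝ) :
    μ {ω | x < ∑ s ∈ jointRounds (fun s => p s ω) t i j, (ψ (Z s ω) - c)} ≤
      ENNReal.ofReal (Real.exp (-x)) := by
  have hA : ∀ s, MeasurableSet[ℱ s]
      {ω | Queried (fun s => p s ω) i s ∧ Queried (fun s => p s ω) j s} := fun s =>
    hS.measurable_query s (Set.toFinite
      {w : Fin K × Fin K | (w.1 = i ∨ w.2 = i) ∧ (w.1 = j ∨ w.2 = j)}).measurableSet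
  have := measure_lt_sum_sub_integral_le hS.measurable hS.map_eq hS.indep hA hψ hY h t x
  refine (measure_mono fun ω hω => ?_).trans this
  change x < _ at hω ⊢
  convert hω using 2
  · ext s
    simp [jointRounds]
  · rw [hc]

theorem Setting.integrable_loss [IsProbabilityMeasure P] (hX : Setting X l L ρ P) (i : Fin K) :
    Integrable (fun z => l (z.1 i) z.2) P := by
  obtain ⟨z, hz⟩ := hX.ae_mem.exists
  obtain ⟨l', hl', heq⟩ :=
    exists_measurable_loss hX.isClosed ⟨_, hz i⟩ hX.measurable_loss hX.loss
  exact TwoPointFeedback.integrable_loss hl' heq hX.mem_Icc (measurable_pi_apply i)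
    (hX.ae_mem.mono fun z hz => hz i)

theorem Setting.integrable_norm_sub_sq [IsProbabilityMeasure P] (hX : Setting X l L ρ P)
    (i j : Fin K) : Integrable (fun z => ‖z.1 i - z.1 j‖ ^ 2) P :=
  TwoPointFeedback.integrable_norm_sub_sq hX.convex hX.L_pos hX.ρ_pos hX.ae_mem hX.loss i j

theorem Setting.norm_sub_le (hX : Setting X l L ρ P) {z : Round d K 𝒴}
    (hz : ∀ i, z.1 i ∈ X) (i j : Fin K) : ‖z.1 i - z.1 j‖ ≤ 4 * L / ρ ^ 2 :=
  have : Nonempty 𝒴 := ⟨z.2⟩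
  hX.loss.norm_sub_le hX.convex hX.ρ_pos (hz i) (hz j) hX.L_pos

theorem Setting.L_mul_norm_sub_le (hX : Setting X l L ρ P) {z : Round d K 𝒴}
    (hz : ∀ i, z.1 i ∈ X) (i j : Fin K) : L * ‖z.1 i - z.1 j‖ ≤ lossBound L ρ / 2 := by
  have h := mul_le_mul_of_nonneg_left (hX.norm_sub_le hz i j) hX.L_pos.le
  have hρ := hX.ρ_pos
  calc _ ≤ _ := h
    _ = _ := by unfold lossBound; field_simp; ring

/-- A Bernstein type tail bound for the loss differences of two experts, with the empirical squared
distance in the place of the variance. -/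
theorem Setting.measure_lossDiff_le [IsProbabilityMeasure μ] [IsProbabilityMeasure P]
    (hX : Setting X l L ρ P) (hS : Sampling P μ ℱ Z p) {a : ℝ} (ha : 0 ≤ a)
    (ha' : a * (2 * lossBound L ρ) ≤ 1) (t : ℕ) (i j : Fin K) (x : ℝ) :
    μ {ω | x < ∑ s ∈ jointRounds (fun s => p s ω) t i j,
      (a * (l ((Z s ω).1 i) (Z s ω).2 - l ((Z s ω).1 j) (Z s ω).2) -
        a ^ 2 * (L ^ 2 * ‖(Z s ω).1 i - (Z s ω).1 j‖ ^ 2) -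
        a * (risk P l (fun f => f i) - risk P l (fun f => f j)))} ≤
      ENNReal.ofReal (Real.exp (-x)) := by
  have hY : Integrable (fun z => a * (l (z.1 i) z.2 - l (z.1 j) z.2)) P :=
    ((hX.integrable_loss i).sub (hX.integrable_loss j)).const_mul a
  refine hS.measure_lt_sum_jointRounds_le
    (ψ := fun z => a * (l (z.1 i) z.2 - l (z.1 j) z.2) - a ^ 2 * (L ^ 2 * ‖z.1 i - z.1 j‖ ^ 2))
    (hY.aestronglyMeasurable.aemeasurable.sub
      (((measurable_norm_sub_sq i j).const_mul _).const_mul _).aemeasurable) hY ?_ ?_ t i j x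
  · filter_upwards [hX.ae_mem] with z hz
    have h1 := (hX.loss z.2).1 _ (hz i) _ (hz j)
    have h2 := hX.L_mul_norm_sub_le hz i j
    set D := l (z.1 i) z.2 - l (z.1 j) z.2
    -- `a ≤ 1 / (2 B)`, and `|D| ≤ B / 2` by the diameter bound.
    have h3 : |a * D| ≤ 1 / 4 := by
      rw [abs_mul, abs_of_nonneg ha]
      nlinarith [mul_le_mul_of_nonneg_left (h1.trans h2) ha]
    have h4 : (a * D) ^ 2 ≤ a ^ 2 * (L ^ 2 * ‖z.1 i - z.1 j‖ ^ 2) := by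
      rw [mul_pow, ← mul_pow L, ← sq_abs D]
      gcongr
    exact (Real.exp_le_exp.2 (by linarith)).trans (exp_sub_sq_le h3)
  · rw [integral_const_mul, integral_sub (hX.integrable_loss i) (hX.integrable_loss j)]
    rfl

/-- The largest possible squared distance of two experts. -/
noncomputable def sqDiam (L ρ : ℝ) : ℝ := 16 * L ^ 2 / ρ ^ 4

theorem Setting.norm_sub_sq_div_mem (hX : Setting X l L ρ P) {z : Round d K 𝒴}
    (hz : ∀ i, z.1 i ∈ X) (i j : Fin K) : ‖z.1 i - z.1 j‖ ^ 2 / sqDiam L ρ ≤ 1 := by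
  have hρ := hX.ρ_pos
  have hL := hX.L_pos
  have hb : sqDiam L ρ = (4 * L / ρ ^ 2) ^ 2 := by unfold sqDiam; field_simp; ring
  rw [div_le_one (by unfold sqDiam; positivity), hb]
  exact pow_le_pow_left₀ (norm_nonneg _) (hX.norm_sub_le hz i j) 2

theorem sqDiam_pos (hL : 0 < L) (hρ : 0 < ρ) : 0 < sqDiam L ρ := by
  unfold sqDiam; positivity

theorem Setting.measure_sqDist_lower_le [IsProbabilityMeasure μ] [IsProbabilityMeasure P]
    (hX : Setting X l L ρ P) (hS : Sampling P μ ℱ Z p) (t : ℕ) (i j : Fin K) (x : ℝ) :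
    μ {ω | x < ∑ s ∈ jointRounds (fun s => p s ω) t i j,
      (-(‖(Z s ω).1 i - (Z s ω).1 j‖ ^ 2 / sqDiam L ρ) - -(sqDist P i j / sqDiam L ρ / 2))} ≤
      ENNReal.ofReal (Real.exp (-x)) := by
  refine hS.measure_lt_sum_jointRounds_le
    (ψ := fun z => -(‖z.1 i - z.1 j‖ ^ 2 / sqDiam L ρ))
    (Y := fun z => -(‖z.1 i - z.1 j‖ ^ 2 / sqDiam L ρ / 2))
    ((measurable_norm_sub_sq i j).div_const _).neg.aemeasurable
    (((hX.integrable_norm_sub_sq i j).div_const _).div_const _).neg ?_ ?_ t i j x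
  · filter_upwards [hX.ae_mem] with z hz
    exact exp_neg_le_of_mem_Icc (div_nonneg (sq_nonneg _) (sqDiam_pos hX.L_pos hX.ρ_pos).le)
      (hX.norm_sub_sq_div_mem hz i j)
  · rw [integral_neg, integral_div, integral_div]
    rfl

theorem Setting.measure_sqDist_upper_le [IsProbabilityMeasure μ] [IsProbabilityMeasure P]
    (hX : Setting X l L ρ P) (hS : Sampling P μ ℱ Z p) (t : ℕ) (i j : Fin K) (x : ℝ) :
    μ {ω | x < ∑ s ∈ jointRounds (fun s => p s ω) t i j,
      (‖(Z s ω).1 i - (Z s ω).1 j‖ ^ 2 / sqDiam L ρ - 2 * (sqDist P i j / sqDiam L ρ))} ≤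
      ENNReal.ofReal (Real.exp (-x)) := by
  refine hS.measure_lt_sum_jointRounds_le
    (ψ := fun z => ‖z.1 i - z.1 j‖ ^ 2 / sqDiam L ρ)
    (Y := fun z => 2 * (‖z.1 i - z.1 j‖ ^ 2 / sqDiam L ρ))
    ((measurable_norm_sub_sq i j).div_const _).aemeasurable
    (((hX.integrable_norm_sub_sq i j).div_const _).const_mul _) ?_ ?_ t i j x
  · filter_upwards [hX.ae_mem] with z hz
    exact exp_le_one_add_two_mul (div_nonneg (sq_nonneg _) (sqDiam_pos hX.L_pos hX.ρ_pos).le)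
      (hX.norm_sub_sq_div_mem hz i j)
  · rw [integral_const_mul, integral_div]
    rfl

/-- Either sign of `a` is allowed, so both tails are covered. -/
theorem Setting.measure_loss_le [IsProbabilityMeasure μ] [IsProbabilityMeasure P]
    (hX : Setting X l L ρ P) (hS : Sampling P μ ℱ Z p) {a : ℝ}
    (ha : |a| * lossBound L ρ ≤ 1 / 4) (t : ℕ) (i : Fin K) (x : ℝ) :
    μ {ω | x < ∑ s ∈ rounds (fun s => p s ω) t i,
      (a * l ((Z s ω).1 i) (Z s ω).2 - (a * lossBound L ρ) ^ 2 - a * risk P l (fun f => f i))} ≤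
      ENNReal.ofReal (Real.exp (-x)) := by
  have hY : Integrable (fun z => a * l (z.1 i) z.2) P := (hX.integrable_loss i).const_mul a
  simp only [← jointRounds_self]
  refine hS.measure_lt_sum_jointRounds_le
    (ψ := fun z => a * l (z.1 i) z.2 - (a * lossBound L ρ) ^ 2)
    (hY.aestronglyMeasurable.aemeasurable.sub_const _) hY ?_ ?_ t i i x
  · filter_upwards [hX.ae_mem] with z hz
    obtain ⟨h1, h2⟩ := hX.mem_Icc _ (hz i) z.2
    have h3 : |a * l (z.1 i) z.2| ≤ 1 / 4 := by
      rw [abs_mul, abs_of_nonneg h1]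
      exact (mul_le_mul_of_nonneg_left h2 (abs_nonneg a)).trans ha
    have h4 : (a * l (z.1 i) z.2) ^ 2 ≤ (a * lossBound L ρ) ^ 2 := by
      rw [mul_pow, mul_pow]
      gcongr
    exact (Real.exp_le_exp.2 (by linarith)).trans (exp_sub_sq_le h3)
  · rw [integral_const_mul]
    rfl

end Events

/-! ### The good events and their probabilities. -/

section GoodEvents

variable {d K : ℕ} {𝒴 Ω : Type*} [MeasurableSpace 𝒴] {X : Set (EuclideanSpace ℝ (Fin d))}
  {l : EuclideanSpace ℝ (Fin d) → 𝒴 → ℝ} {L ρ δ : ℝ} {P : Measure (Round d K 𝒴)}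
  {mΩ : MeasurableSpace Ω} {μ : Measure Ω} {ℱ : Filtration ℕ mΩ} {Z : ℕ → Ω → Round d K 𝒴}
  {p : ℕ → Ω → Fin K × Fin K}

/-- The deviations of all loss differences are controlled in all rounds, for all scales of a dyadic
grid. -/
def LossDiffEvent (P : Measure (Round d K 𝒴)) (l : EuclideanSpace ℝ (Fin d) → 𝒴 → ℝ) (L ρ δ : ℝ)
    (T : ℕ) (p : ℕ → Fin K × Fin K) (z : ℕ → Round d K 𝒴) : Prop :=
  ∀ t ∈ Finset.range T, ∀ w ∈ (Finset.univ : Finset (Fin K × Fin K)) ×ˢ Finset.range (t + 2),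
    ∑ s ∈ jointRounds p (t + 1) w.1.1 w.1.2,
      ((1 / 2) ^ w.2 / (2 * lossBound L ρ) *
          (l ((z s).1 w.1.1) (z s).2 - l ((z s).1 w.1.2) (z s).2) -
        ((1 / 2) ^ w.2 / (2 * lossBound L ρ)) ^ 2 *
          (L ^ 2 * ‖(z s).1 w.1.1 - (z s).1 w.1.2‖ ^ 2) -
        (1 / 2) ^ w.2 / (2 * lossBound L ρ) *
          (risk P l (fun f => f w.1.1) - risk P l (fun f => f w.1.2))) ≤
      2 * Real.log (4 * K * (deltaRound δ (t + 1))⁻¹)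

/-- The empirical squared distances after round `T` are comparable to their means. -/
def SqDistEvent (P : Measure (Round d K 𝒴)) (L ρ x : ℝ)
    (T : ℕ) (p : ℕ → Fin K × Fin K) (z : ℕ → Round d K 𝒴) : Prop :=
  ∀ w ∈ (Finset.univ : Finset (Fin K × Fin K)),
    ∑ s ∈ jointRounds p T w.1 w.2,
      (-(‖(z s).1 w.1 - (z s).1 w.2‖ ^ 2 / sqDiam L ρ) - -(sqDist P w.1 w.2 / sqDiam L ρ / 2)) ≤ x ∧
    ∑ s ∈ jointRounds p T w.1 w.2,
      (‖(z s).1 w.1 - (z s).1 w.2‖ ^ 2 / sqDiam L ρ - 2 * (sqDist P w.1 w.2 / sqDiam L ρ)) ≤ x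

/-- The deviations of the losses of the experts after round `T` are controlled, at a scale suited to
`n` queries. -/
def LossEvent (P : Measure (Round d K 𝒴)) (l : EuclideanSpace ℝ (Fin d) → 𝒴 → ℝ) (L ρ x : ℝ)
    (T : ℕ) (p : ℕ → Fin K × Fin K) (z : ℕ → Round d K 𝒴) : Prop :=
  ∀ w ∈ (Finset.univ : Finset (Fin K)) ×ˢ Finset.Icc 1 T, Real.sqrt (x / w.2) ≤ 1 / 4 →
    ∀ a : ℝ, |a| * lossBound L ρ = Real.sqrt (x / w.2) →
    ∑ s ∈ rounds p T w.1,
      (a * l ((z s).1 w.1) (z s).2 - (a * lossBound L ρ) ^ 2 - a * risk P l (fun f => f w.1)) ≤ x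

theorem measure_exists_mem_le {ι : Type*} (s : Finset ι) (S : ι → Set Ω) {c : ℝ}
    (h : ∀ i ∈ s, μ (S i) ≤ ENNReal.ofReal c) :
    μ {ω | ∃ i ∈ s, ω ∈ S i} ≤ ENNReal.ofReal (s.card * c) := by
  have : {ω | ∃ i ∈ s, ω ∈ S i} = ⋃ i ∈ s, S i := by ext ω; simp
  rw [this]
  calc _ ≤ _ := measure_biUnion_finset_le s S
    _ ≤ _ := Finset.sum_le_card_nsmul s _ _ h
    _ = _ := by
      rw [nsmul_eq_mul, ENNReal.ofReal_mul (Nat.cast_nonneg _), ENNReal.ofReal_natCast]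

theorem measure_or_le {S S' : Set Ω} {c : ℝ} (hc : 0 ≤ c) (h : μ S ≤ ENNReal.ofReal c)
    (h' : μ S' ≤ ENNReal.ofReal c) : μ (S ∪ S') ≤ ENNReal.ofReal (2 * c) := by
  rw [two_mul, ENNReal.ofReal_add hc hc]
  exact (measure_union_le S S').trans (add_le_add h h')

theorem sum_deltaRound_le (hδ : 0 ≤ δ) (T : ℕ) :
    ∑ t ∈ Finset.range T, deltaRound δ (t + 1) ≤ δ := by
  have h : ∀ T : ℕ, ∑ t ∈ Finset.range T, deltaRound δ (t + 1) = δ * (1 - 1 / (T + 1)) := by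
    intro T
    induction T with
    | zero => simp
    | succ T ih =>
      rw [Finset.sum_range_succ, ih, deltaRound]
      push_cast
      field_simp
      ring
  rw [h]
  have : (0 : ℝ) ≤ 1 / (T + 1) := by positivity
  nlinarith

theorem deltaRound_pos (hδ : 0 < δ) (t : ℕ) : 0 < deltaRound δ (t + 1) := by
  unfold deltaRound; positivity

theorem Setting.measure_not_lossDiffEvent_le [IsProbabilityMeasure μ] [IsProbabilityMeasure P]
    (hX : Setting X l L ρ P) (hS : Sampling P μ ℱ Z p) (hK : 1 ≤ K) (hδ : 0 < δ) (hδ1 : δ < 1)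
    (T : ℕ) :
    μ {ω | ¬ LossDiffEvent P l L ρ δ T (fun s => p s ω) (fun s => Z s ω)} ≤
      ENNReal.ofReal δ := by
  have hB := lossBound_pos hX.L_pos hX.ρ_pos
  have hstep : ∀ t ∈ Finset.range T, μ {ω | ∃ w ∈ (Finset.univ : Finset (Fin K × Fin K)) ×ˢ
      Finset.range (t + 2), ω ∈ {ω | 2 * Real.log (4 * K * (deltaRound δ (t + 1))⁻¹) <
      ∑ s ∈ jointRounds (fun s => p s ω) (t + 1) w.1.1 w.1.2,
      ((1 / 2) ^ w.2 / (2 * lossBound L ρ) *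
          (l ((Z s ω).1 w.1.1) (Z s ω).2 - l ((Z s ω).1 w.1.2) (Z s ω).2) -
        ((1 / 2) ^ w.2 / (2 * lossBound L ρ)) ^ 2 *
          (L ^ 2 * ‖(Z s ω).1 w.1.1 - (Z s ω).1 w.1.2‖ ^ 2) -
        (1 / 2) ^ w.2 / (2 * lossBound L ρ) *
          (risk P l (fun f => f w.1.1) - risk P l (fun f => f w.1.2)))}} ≤
      ENNReal.ofReal (deltaRound δ (t + 1)) := by
    intro t _
    refine (measure_exists_mem_le _ _ fun w _ => hX.measure_lossDiff_le hS (by positivity) ?_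
      (t + 1) w.1.1 w.1.2 _).trans (ENNReal.ofReal_le_ofReal ?_)
    · rw [div_mul_cancel₀ _ (by positivity)]
      exact pow_le_one₀ (by norm_num) (by norm_num)
    · have hd := deltaRound_pos hδ t
      have hK' : (0 : ℝ) < K := by exact_mod_cast hK
      -- The factor 2 in the threshold squares `δ_t / (4 K)`: one power pays for the `K²` pairs and
      -- the `t + 2` scales, the other is summed over the rounds.
      have he : Real.exp (-(2 * Real.log (4 * K * (deltaRound δ (t + 1))⁻¹))) =
          (deltaRound δ (t + 1) / (4 * K)) ^ 2 := by
        rw [← Real.log_rpow (by positivity), ← Real.log_inv, Real.exp_log (by positivity)]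
        norm_num
        field_simp
      have hd1 : (t + 2 : ℝ) * deltaRound δ (t + 1) ≤ 1 := by
        unfold deltaRound
        push_cast
        rw [mul_div_assoc', div_le_one (by positivity)]
        nlinarith [mul_nonneg (Nat.cast_nonneg (α := ℝ) t) (Nat.cast_nonneg (α := ℝ) t)]
      rw [he]
      simp only [Finset.card_product, Finset.card_univ, Fintype.card_prod, Fintype.card_fin,
        Finset.card_range]
      push_cast
      calc (K : ℝ) * K * (t + 2) * (deltaRound δ (t + 1) / (4 * K)) ^ 2 =
            ((t + 2 : ℝ) * deltaRound δ (t + 1)) * deltaRound δ (t + 1) / 16 := by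
            field_simp; norm_num
        _ ≤ 1 * deltaRound δ (t + 1) / 16 := by gcongr
        _ ≤ deltaRound δ (t + 1) := by linarith
  calc _ ≤ μ (⋃ t ∈ Finset.range T, _) := measure_mono fun ω hω => ?_
    _ ≤ _ := measure_biUnion_finset_le _ _
    _ ≤ _ := Finset.sum_le_sum hstep
    _ = ENNReal.ofReal (∑ t ∈ Finset.range T, deltaRound δ (t + 1)) :=
      (ENNReal.ofReal_sum_of_nonneg fun t _ => (deltaRound_pos hδ t).le).symm
    _ ≤ _ := ENNReal.ofReal_le_ofReal (sum_deltaRound_le hδ.le T)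
  change ¬ LossDiffEvent P l L ρ δ T (fun s => p s ω) (fun s => Z s ω) at hω
  unfold LossDiffEvent at hω
  push Not at hω
  obtain ⟨t, ht, w, hw, hlt⟩ := hω
  exact Set.mem_biUnion ht ⟨w, hw, hlt⟩

theorem Setting.measure_not_sqDistEvent_le [IsProbabilityMeasure μ] [IsProbabilityMeasure P]
    (hX : Setting X l L ρ P) (hS : Sampling P μ ℱ Z p) {T : ℕ} (x : ℝ) :
    μ {ω | ¬ SqDistEvent P L ρ x T (fun s => p s ω) (fun s => Z s ω)} ≤
      ENNReal.ofReal (2 * K ^ 2 * Real.exp (-x)) := by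
  have h := measure_exists_mem_le (Finset.univ : Finset (Fin K × Fin K)) _ fun w _ =>
    measure_or_le (Real.exp_pos _).le (hX.measure_sqDist_lower_le hS T w.1 w.2 x)
      (hX.measure_sqDist_upper_le hS T w.1 w.2 x)
  refine (measure_mono fun ω hω => ?_).trans (h.trans (ENNReal.ofReal_le_ofReal (le_of_eq ?_)))
  · change ¬ SqDistEvent P L ρ x T (fun s => p s ω) (fun s => Z s ω) at hω
    unfold SqDistEvent at hω
    simp only [not_forall, not_and_or, not_le] at hω
    obtain ⟨w, hw, hlt⟩ := hω
    exact ⟨w, hw, hlt⟩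
  · simp only [Finset.card_univ, Fintype.card_prod, Fintype.card_fin]
    push_cast
    ring

theorem Setting.measure_not_lossEvent_le [IsProbabilityMeasure μ] [IsProbabilityMeasure P]
    (hX : Setting X l L ρ P) (hS : Sampling P μ ℱ Z p) {T : ℕ} (x : ℝ) :
    μ {ω | ¬ LossEvent P l L ρ x T (fun s => p s ω) (fun s => Z s ω)} ≤
      ENNReal.ofReal (2 * (K * T) * Real.exp (-x)) := by
  have hB := lossBound_pos hX.L_pos hX.ρ_pos
  have hw : ∀ w ∈ (Finset.univ : Finset (Fin K)) ×ˢ Finset.Icc 1 T,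
      μ {ω | ¬ (Real.sqrt (x / w.2) ≤ 1 / 4 →
        ∀ a : ℝ, |a| * lossBound L ρ = Real.sqrt (x / w.2) →
        ∑ s ∈ rounds (fun s => p s ω) T w.1, (a * l ((Z s ω).1 w.1) (Z s ω).2 -
          (a * lossBound L ρ) ^ 2 - a * risk P l (fun f => f w.1)) ≤ x)} ≤
      ENNReal.ofReal (2 * Real.exp (-x)) := by
    intro w _
    by_cases h4 : Real.sqrt (x / w.2) ≤ 1 / 4
    · have h0 := Real.sqrt_nonneg (x / w.2)
      have habs : |Real.sqrt (x / w.2) / lossBound L ρ| * lossBound L ρ =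
          Real.sqrt (x / w.2) := by
        rw [abs_of_nonneg (by positivity), div_mul_cancel₀ _ hB.ne']
      refine (measure_mono fun ω hω => ?_).trans (measure_or_le (Real.exp_pos _).le
        (hX.measure_loss_le hS (a := Real.sqrt (x / w.2) / lossBound L ρ)
          (habs.trans_le h4) T w.1 x)
        (hX.measure_loss_le hS (a := -(Real.sqrt (x / w.2) / lossBound L ρ))
          (by rw [abs_neg]; exact habs.trans_le h4) T w.1 x))
      change ¬ (Real.sqrt (x / w.2) ≤ 1 / 4 → _) at hω
      push Not at hω
      obtain ⟨-, a, ha, hlt⟩ := hω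
      have ha' : |a| = Real.sqrt (x / w.2) / lossBound L ρ := by
        rw [eq_div_iff hB.ne', ha]
      rcases eq_or_eq_neg_of_abs_eq ha' with rfl | rfl
      · exact Or.inl hlt
      · exact Or.inr hlt
    · refine (measure_mono (t := ∅) fun ω hω => ?_).trans (by simp)
      change ¬ (Real.sqrt (x / w.2) ≤ 1 / 4 → _) at hω
      exact (hω fun h => absurd h h4).elim
  refine (measure_mono fun ω hω => ?_).trans
    ((measure_exists_mem_le _ _ hw).trans (ENNReal.ofReal_le_ofReal (le_of_eq ?_)))
  · change ¬ LossEvent P l L ρ x T (fun s => p s ω) (fun s => Z s ω) at hω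
    unfold LossEvent at hω
    rw [not_forall] at hω
    obtain ⟨w, hω⟩ := hω
    rw [Classical.not_imp] at hω
    exact ⟨w, hω.1, hω.2⟩
  · simp only [Finset.card_product, Finset.card_univ, Fintype.card_fin, Nat.card_Icc,
      add_tsub_cancel_right]
    push_cast
    ring

end GoodEvents

/-- Here `G` is a deviation, `q` stands for `L d̂` and `a` for `α`. The best scale depends on the
random `q`, so it is chosen from a fixed grid, up to a factor 2. -/
theorem le_mul_max_of_forall_dyadic {B q a G : ℝ} {t : ℕ} (hB : 0 < B) (hqB : q ≤ B / 2)
    (ha : 0 < a) (hat : (1 / 2) ^ t ≤ a)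
    (h : ∀ m ≤ t, (1 / 2) ^ m / (2 * B) * G - ((1 / 2) ^ m / (2 * B)) ^ 2 * q ^ 2 ≤ 2 * a ^ 2)
    (hq0 : 0 ≤ q) : G ≤ 5 * max (a * q) (B * a ^ 2) := by
  have hscale : ∀ m ≤ t, (1 / 2 : ℝ) ^ m * (2 * B * G) ≤
      ((1 / 2) ^ m * q) ^ 2 + 8 * (B * a) ^ 2 := by
    intro m hm
    have h1 := mul_le_mul_of_nonneg_right (h m hm) (by positivity : (0 : ℝ) ≤ (2 * B) ^ 2)
    have e : ((1 / 2 : ℝ) ^ m / (2 * B) * G - ((1 / 2) ^ m / (2 * B)) ^ 2 * q ^ 2) * (2 * B) ^ 2 =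
        (1 / 2) ^ m * (2 * B * G) - ((1 / 2) ^ m * q) ^ 2 := by
      field_simp
    rw [e] at h1
    linarith
  rcases le_or_gt q (2 * B * a) with hq | hq
  · have h0 := hscale 0 (Nat.zero_le _)
    simp only [pow_zero, one_mul] at h0
    have h1 : 2 * B * G ≤ 2 * B * (a * q + 4 * (B * a ^ 2)) := by nlinarith
    have h2 := le_of_mul_le_mul_left h1 (by positivity)
    linarith [le_max_left (a * q) (B * a ^ 2), le_max_right (a * q) (B * a ^ 2)]
  · have hq1 : 0 < q := lt_of_le_of_lt (by positivity) hq
    -- This puts `w = (1 / 2) ^ m` between `2Ba/q` and `4Ba/q`; then `(wq - 2Ba)(4Ba - wq) ≥ 0` is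
    -- exactly the bound with constant 3.
    obtain ⟨m, hm1, hm2⟩ := exists_nat_pow_near_of_lt_one (x := 2 * B * a / q) (y := (1 / 2 : ℝ))
      (by positivity) ((div_le_one hq1).2 hq.le) (by norm_num) (by norm_num)
    have hmt : m ≤ t := by
      by_contra hlt
      push Not at hlt
      have h1 : (1 / 2 : ℝ) ^ m ≤ (1 / 2) ^ t :=
        pow_le_pow_of_le_one (by norm_num) (by norm_num) hlt.le
      have h2 := (hm2.trans h1).trans hat
      rw [div_le_iff₀ hq1] at h2
      nlinarith
    have h0 := hscale m hmt
    rw [div_le_iff₀ hq1] at hm2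
    rw [lt_div_iff₀ hq1, pow_succ] at hm1
    set w := (1 / 2 : ℝ) ^ m
    have hw : 0 < w := by positivity
    have h1 : w * (2 * B) * G ≤ w * (2 * B) * (3 * (a * q)) := by
      nlinarith [mul_nonneg (sub_nonneg.2 hm2) (by linarith : 0 ≤ 4 * B * a - w * q)]
    have h2 := le_of_mul_le_mul_left h1 (by positivity)
    have h3 : 0 ≤ a * q := by positivity
    linarith [le_max_left (a * q) (B * a ^ 2)]

/-! ### Symmetry of the statistics, and the confidence width. -/

section Statistics

variable {d K : ℕ} {𝒴 : Type*} {l : EuclideanSpace ℝ (Fin d) → 𝒴 → ℝ} {L ρ δ : ℝ}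
  {p : ℕ → Fin K × Fin K} {z : ℕ → Round d K 𝒴}

theorem jointEmpRisk_comm (t : ℕ) (i j k : Fin K) :
    jointEmpRisk l p z t i j k = jointEmpRisk l p z t j i k := by
  simp only [jointEmpRisk, jointRounds_comm t i j, jointCount_comm t i j]

theorem empDist_nonneg (t : ℕ) (i j : Fin K) : 0 ≤ empDist p z t i j := Real.sqrt_nonneg _

theorem empDist_sq (t : ℕ) (i j : Fin K) : empDist p z t i j ^ 2 =
    (∑ s ∈ jointRounds p t i j, ‖(z s).1 i - (z s).1 j‖ ^ 2) / (jointCount p t i j : ℝ) :=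
  Real.sq_sqrt (by positivity)

theorem alpha_comm (t : ℕ) (i j : Fin K) (δ : ℝ) : alpha p t i j δ = alpha p t j i δ := by
  simp only [alpha, jointCount_comm t i j]

theorem alpha_nonneg (t : ℕ) (i j : Fin K) (δ : ℝ) : 0 ≤ alpha p t i j δ := Real.sqrt_nonneg _

/-- The common width of the confidence intervals for the loss differences. -/
noncomputable def width (L ρ δ : ℝ) (p : ℕ → Fin K × Fin K) (z : ℕ → Round d K 𝒴) (t : ℕ)
    (i j : Fin K) : ℝ :=
  max (L * alpha p t i j (deltaRound δ t) * empDist p z t i j)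
    (lossBound L ρ * alpha p t i j (deltaRound δ t) ^ 2)

theorem width_comm (t : ℕ) (i j : Fin K) : width L ρ δ p z t i j = width L ρ δ p z t j i := by
  simp only [width, alpha_comm t i j, empDist_comm t i j]

theorem width_nonneg (hL : 0 < L) (t : ℕ) (i j : Fin K) : 0 ≤ width L ρ δ p z t i j :=
  le_max_of_le_left (mul_nonneg (mul_nonneg hL.le (alpha_nonneg _ _ _ _)) (empDist_nonneg _ _ _))

theorem testStat_eq (t : ℕ) (i j : Fin K) : testStat l L ρ δ p z t i j =
    jointEmpRisk l p z t i j j - jointEmpRisk l p z t i j i - 6 * width L ρ δ p z t i j := rfl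

end Statistics

/-! ### Consequences of the good events. -/

section Deterministic

variable {d K : ℕ} {𝒴 : Type*} [MeasurableSpace 𝒴] {X : Set (EuclideanSpace ℝ (Fin d))}
  {l : EuclideanSpace ℝ (Fin d) → 𝒴 → ℝ} {L ρ δ : ℝ} {P : Measure (Round d K 𝒴)}
  {p : ℕ → Fin K × Fin K} {z : ℕ → Round d K 𝒴} {T : ℕ}

theorem one_le_log_deltaRound (hK : 1 ≤ K) (hδ : 0 < δ) (hδ1 : δ < 1) (t : ℕ) :
    1 ≤ Real.log (4 * K * (deltaRound δ (t + 1))⁻¹) := by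
  have hd := deltaRound_pos hδ t
  have hd1 : deltaRound δ (t + 1) ≤ 1 := by
    unfold deltaRound
    push_cast
    rw [div_le_one (by positivity)]
    nlinarith [(Nat.cast_nonneg t : (0 : ℝ) ≤ t)]
  have hK' : (1 : ℝ) ≤ K := by exact_mod_cast hK
  have h1 : 1 ≤ (deltaRound δ (t + 1))⁻¹ := (one_le_inv₀ hd).2 hd1
  rw [Real.le_log_iff_exp_le (by positivity)]
  nlinarith [Real.exp_one_lt_three]

theorem alpha_sq (hK : 1 ≤ K) (hδ : 0 < δ) (hδ1 : δ < 1) (t : ℕ) (i j : Fin K) :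
    alpha p (t + 1) i j (deltaRound δ (t + 1)) ^ 2 =
      Real.log (4 * K * (deltaRound δ (t + 1))⁻¹) / (jointCount p (t + 1) i j : ℝ) :=
  Real.sq_sqrt (div_nonneg (zero_le_one.trans (one_le_log_deltaRound hK hδ hδ1 t))
    (Nat.cast_nonneg _))

theorem Setting.L_mul_empDist_le (hX : Setting X l L ρ P) (hz : ∀ s i, (z s).1 i ∈ X) (t : ℕ)
    (i j : Fin K) : L * empDist p z t i j ≤ lossBound L ρ / 2 := by
  have hL := hX.L_pos
  have hB := lossBound_pos hX.L_pos hX.ρ_pos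
  refine abs_le_of_sq_le_sq' ?_ (by positivity) |>.2
  rw [mul_pow, empDist_sq, mul_div_assoc', Finset.mul_sum]
  refine div_le_of_le_mul₀ (Nat.cast_nonneg _) (sq_nonneg _) ?_
  rw [mul_comm, ← nsmul_eq_mul, jointCount]
  refine Finset.sum_le_card_nsmul _ _ _ fun s _ => ?_
  rw [← mul_pow]
  exact pow_le_pow_left₀ (by positivity) (hX.L_mul_norm_sub_le (hz s) i j) 2

theorem LossDiffEvent.sub_le (hE : LossDiffEvent P l L ρ δ T p z) (hX : Setting X l L ρ P)
    (hz : ∀ s i, (z s).1 i ∈ X) (hK : 1 ≤ K) (hδ : 0 < δ) (hδ1 : δ < 1) {t : ℕ} (ht : t < T)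
    {i j : Fin K} (hn : 0 < jointCount p (t + 1) i j) :
    jointEmpRisk l p z (t + 1) i j i - jointEmpRisk l p z (t + 1) i j j -
      (risk P l (fun f => f i) - risk P l (fun f => f j)) ≤
      5 * width L ρ δ p z (t + 1) i j := by
  have hn' : (0 : ℝ) < jointCount p (t + 1) i j := by exact_mod_cast hn
  have hl := one_le_log_deltaRound hK hδ hδ1 t
  have ha2 := alpha_sq (p := p) hK hδ hδ1 t i j
  have ha0 := alpha_nonneg (p := p) (t + 1) i j (deltaRound δ (t + 1))
  set a := alpha p (t + 1) i j (deltaRound δ (t + 1))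
  have hat : 1 / ((t + 1 : ℕ) : ℝ) ≤ a ^ 2 := by
    rw [ha2]
    have : (jointCount p (t + 1) i j : ℝ) ≤ (t + 1 : ℕ) := by exact_mod_cast jointCount_le _ _ _
    gcongr
  have hapos : 0 < a := by
    refine lt_of_le_of_ne ha0 fun h => ?_
    rw [← h] at hat
    have : (0 : ℝ) < 1 / ((t + 1 : ℕ) : ℝ) := by positivity
    norm_num at hat
    linarith
  -- The grid is fine enough: `a² ≥ 1 / (t + 1)`, because the logarithm is at least 1 and there are
  -- at most `t + 1` joint rounds.
  have hpow : (1 / 2 : ℝ) ^ (t + 1) ≤ a := by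
    have h1 : (1 / 2 : ℝ) ^ (t + 1) ≤ 1 / ((t + 1 : ℕ) : ℝ) := by
      rw [one_div_pow]
      have : ((t + 1 : ℕ) : ℝ) ≤ 2 ^ (t + 1) := by exact_mod_cast Nat.lt_two_pow_self.le
      gcongr
    have h2 : (1 / 2 : ℝ) ^ (t + 1) ≤ 1 := pow_le_one₀ (by norm_num) (by norm_num)
    have h3 : (0 : ℝ) < (1 / 2 : ℝ) ^ (t + 1) := by positivity
    refine abs_le_of_sq_le_sq' ?_ ha0 |>.2
    nlinarith
  have hwidth : width L ρ δ p z (t + 1) i j =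
      max (a * (L * empDist p z (t + 1) i j)) (lossBound L ρ * a ^ 2) := by
    rw [width]; congr 1; ring
  rw [hwidth]
  refine le_mul_max_of_forall_dyadic (t := t + 1) (lossBound_pos hX.L_pos hX.ρ_pos)
    (hX.L_mul_empDist_le hz (t + 1) i j) hapos hpow (fun m hm => ?_)
    (mul_nonneg hX.L_pos.le (empDist_nonneg _ _ _))
  have h := hE t (Finset.mem_range.2 ht) ((i, j), m) (Finset.mem_product.2
    ⟨Finset.mem_univ _, Finset.mem_range.2 (by omega)⟩)
  simp only [Finset.sum_sub_distrib, ← Finset.mul_sum, Finset.sum_const, nsmul_eq_mul] at h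
  rw [mul_pow, empDist_sq, ha2]
  simp only [jointEmpRisk]
  rw [show (jointRounds p (t + 1) i j).card = jointCount p (t + 1) i j from rfl] at h
  rw [← mul_div_assoc 2, le_div_iff₀ hn']
  refine le_trans (le_of_eq ?_) h
  field_simp
  ring

theorem jointEmpRisk_mem_Icc (hX : Setting X l L ρ P) (hz : ∀ s i, (z s).1 i ∈ X) (t : ℕ)
    (i j k : Fin K) : jointEmpRisk l p z t i j k ∈ Set.Icc 0 (lossBound L ρ) := by
  have hl := fun s => hX.mem_Icc _ (hz s k) (z s).2
  refine ⟨div_nonneg (Finset.sum_nonneg fun s _ => (hl s).1) (Nat.cast_nonneg _), ?_⟩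
  refine div_le_of_le_mul₀ (Nat.cast_nonneg _) (lossBound_pos hX.L_pos hX.ρ_pos).le ?_
  rw [mul_comm, ← nsmul_eq_mul, jointCount]
  exact Finset.sum_le_card_nsmul _ _ _ fun s _ => (hl s).2

/-- After a single joint observation `α² ≥ 1`, so the penalty is at least `6 B`, while the empirical
risks differ by at most `B`. -/
theorem Eliminates.two_le_jointCount {t : ℕ} {u v : Fin K}
    (h : Eliminates l L ρ δ p z (t + 1) u v) (hX : Setting X l L ρ P)
    (hz : ∀ s i, (z s).1 i ∈ X) (hK : 1 ≤ K) (hδ : 0 < δ) (hδ1 : δ < 1) :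
    u ≠ v ∧ 2 ≤ jointCount p (t + 1) u v := by
  obtain ⟨hn, hpos⟩ := h
  rw [testStat_eq] at hpos
  have hB := lossBound_pos hX.L_pos hX.ρ_pos
  have hw := width_nonneg (ρ := ρ) (δ := δ) (p := p) (z := z) hX.L_pos (t + 1) u v
  refine ⟨?_, ?_⟩
  · rintro rfl
    linarith
  · by_contra hlt
    have h1 : jointCount p (t + 1) u v = 1 := by omega
    have ha2 := alpha_sq (p := p) hK hδ hδ1 t u v
    rw [h1, Nat.cast_one, div_one] at ha2
    have hl := one_le_log_deltaRound hK hδ hδ1 t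
    rw [← ha2] at hl
    have h2 : lossBound L ρ * alpha p (t + 1) u v (deltaRound δ (t + 1)) ^ 2 ≤
      width L ρ δ p z (t + 1) u v := le_max_right _ _
    have h3 := (jointEmpRisk_mem_Icc (p := p) hX hz (t + 1) u v v).2
    have h4 := (jointEmpRisk_mem_Icc (p := p) hX hz (t + 1) u v u).1
    nlinarith

/-- Elimination requires an empirical disadvantage above 6 widths, but a risk minimizer shows at
most 5. -/
theorem LossDiffEvent.best_mem_survivors (hE : LossDiffEvent P l L ρ δ T p z)
    (hX : Setting X l L ρ P) (hz : ∀ s i, (z s).1 i ∈ X) (hK : 1 ≤ K) (hδ : 0 < δ) (hδ1 : δ < 1)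
    {i : Fin K} (hi : ∀ j, risk P l (fun f => f i) ≤ risk P l (fun f => f j)) {t : ℕ}
    (ht : t ≤ T) : i ∈ survivors l L ρ δ p z t := by
  induction t with
  | zero => simp [survivors]
  | succ t ih =>
    refine Finset.mem_filter.2 ⟨ih (by omega), fun u hu => ?_⟩
    obtain ⟨hn, hpos⟩ := hu
    rw [testStat_eq] at hpos
    rw [jointCount_comm] at hn
    have h := hE.sub_le hX hz hK hδ hδ1 ht hn
    rw [jointEmpRisk_comm, jointEmpRisk_comm _ _ _ u, width_comm] at h
    have hw := width_nonneg (ρ := ρ) (δ := δ) (p := p) (z := z) hX.L_pos (t + 1) u i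
    linarith [hi u]

/-- Excess risk of a survivor. -/
theorem LossDiffEvent.risk_sub_le (hE : LossDiffEvent P l L ρ δ T p z)
    (hX : Setting X l L ρ P) (hz : ∀ s i, (z s).1 i ∈ X) (hK : 1 ≤ K) (hδ : 0 < δ) (hδ1 : δ < 1)
    (hT : 0 < T) {i k : Fin K} (hk : k ∈ survivors l L ρ δ p z T)
    (hn : 0 < jointCount p T i k) :
    risk P l (fun f => f k) - risk P l (fun f => f i) ≤ 11 * width L ρ δ p z T i k := by
  obtain ⟨t, rfl⟩ := Nat.exists_eq_succ_of_ne_zero hT.ne'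
  have h1 : ¬ Eliminates l L ρ δ p z (t + 1) i k := (Finset.mem_filter.1 hk).2 i
  have h2 : testStat l L ρ δ p z (t + 1) i k ≤ 0 := not_lt.1 fun h => h1 ⟨hn, h⟩
  rw [testStat_eq] at h2
  have h3 := hE.sub_le hX hz hK hδ hδ1 (Nat.lt_succ_self t) hn
  simp only [Nat.succ_eq_add_one] at *
  linarith

theorem SqDistEvent.empDist_sq_le {x : ℝ} (hE : SqDistEvent P L ρ x T p z) (hL : 0 < L)
    (hρ : 0 < ρ) {i j : Fin K} (hn : 0 < jointCount p T i j) :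
    empDist p z T i j ^ 2 ≤
      2 * sqDist P i j + sqDiam L ρ * (x / (jointCount p T i j : ℝ)) := by
  have hn' : (0 : ℝ) < jointCount p T i j := by exact_mod_cast hn
  have hb := sqDiam_pos hL hρ
  have h := (hE (i, j) (Finset.mem_univ _)).2
  simp only [Finset.sum_sub_distrib, ← Finset.sum_div, Finset.sum_const, nsmul_eq_mul] at h
  rw [show (jointRounds p T i j).card = jointCount p T i j from rfl] at h
  rw [empDist_sq, div_le_iff₀ hn']
  rw [sub_le_iff_le_add, div_le_iff₀ hb] at h
  refine h.trans (le_of_eq ?_)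
  field_simp
  ring

theorem SqDistEvent.sqDist_le {x : ℝ} (hE : SqDistEvent P L ρ x T p z) (hL : 0 < L)
    (hρ : 0 < ρ) {i j : Fin K} (hn : 0 < jointCount p T i j) :
    sqDist P i j ≤
      2 * empDist p z T i j ^ 2 + 2 * (sqDiam L ρ * (x / (jointCount p T i j : ℝ))) := by
  have hn' : (0 : ℝ) < jointCount p T i j := by exact_mod_cast hn
  have hb := sqDiam_pos hL hρ
  have h := (hE (i, j) (Finset.mem_univ _)).1
  simp only [Finset.sum_sub_distrib, Finset.sum_neg_distrib, ← Finset.sum_div, Finset.sum_const,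
    nsmul_eq_mul] at h
  rw [show (jointRounds p T i j).card = jointCount p T i j from rfl] at h
  rw [empDist_sq]
  have h2 : (jointCount p T i j : ℝ) * (sqDist P i j / sqDiam L ρ / 2) ≤
      (∑ s ∈ jointRounds p T i j, ‖(z s).1 i - (z s).1 j‖ ^ 2) / sqDiam L ρ + x := by
    rw [show (jointCount p T i j : ℝ) * (sqDist P i j / sqDiam L ρ / 2) =
      jointCount p T i j * sqDist P i j / sqDiam L ρ / 2 by ring]
    linarith
  have h3 := mul_le_mul_of_nonneg_left h2
    (by positivity : 0 ≤ 2 * sqDiam L ρ / (jointCount p T i j : ℝ))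
  refine le_trans (le_of_eq ?_) (h3.trans (le_of_eq ?_)) <;> field_simp

theorem LossEvent.abs_sub_le {x : ℝ} (hx : 0 < x) (hE : LossEvent P l L ρ x T p z)
    (hX : Setting X l L ρ P) [IsProbabilityMeasure P] (hz : ∀ s i, (z s).1 i ∈ X) {i : Fin K}
    (hn : 0 < count p T i) :
    |empRisk l p z T i - risk P l (fun f => f i)| ≤
      4 * lossBound L ρ * Real.sqrt (x / (count p T i : ℝ)) := by
  have hn' : (0 : ℝ) < count p T i := by exact_mod_cast hn
  have hB := lossBound_pos hX.L_pos hX.ρ_pos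
  have hr : 0 < Real.sqrt (x / (count p T i : ℝ)) := Real.sqrt_pos.2 (by positivity)
  have hr2 : Real.sqrt (x / (count p T i : ℝ)) ^ 2 = x / (count p T i : ℝ) :=
    Real.sq_sqrt (by positivity)
  rcases le_or_gt (Real.sqrt (x / (count p T i : ℝ))) (1 / 4) with h4 | h4
  -- The event holds for every possible number of queries, so the scale may be tuned to the random
  -- count.
  · have h := hE (i, count p T i) (Finset.mem_product.2 ⟨Finset.mem_univ _,
      Finset.mem_Icc.2 ⟨hn, count_le T i⟩⟩) h4
    simp only at h
    set r := Real.sqrt (x / (count p T i : ℝ))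
    have hx' : x = count p T i * r ^ 2 := by rw [hr2]; field_simp
    have hsum : ∀ a : ℝ, ∑ s ∈ rounds p T i, (a * l ((z s).1 i) (z s).2 -
        (a * lossBound L ρ) ^ 2 - a * risk P l (fun f => f i)) =
        count p T i * (a * (empRisk l p z T i - risk P l (fun f => f i)) -
          (a * lossBound L ρ) ^ 2) := by
      intro a
      simp only [Finset.sum_sub_distrib, ← Finset.mul_sum, Finset.sum_const, nsmul_eq_mul,
        empRisk]
      rw [show (rounds p T i).card = count p T i from rfl]
      field_simp
      ring
    have key : ∀ a : ℝ, |a| * lossBound L ρ = r →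
        a * (empRisk l p z T i - risk P l (fun f => f i)) ≤ 2 * r ^ 2 := by
      intro a ha
      have h1 := h a ha
      rw [hsum a, hx'] at h1
      have h2 := le_of_mul_le_mul_left h1 hn'
      have h3 : (a * lossBound L ρ) ^ 2 = r ^ 2 := by rw [← ha, mul_pow, mul_pow, sq_abs]
      linarith
    have hrB : |r / lossBound L ρ| * lossBound L ρ = r := by
      rw [abs_of_nonneg (by positivity), div_mul_cancel₀ _ hB.ne']
    have k1 := key (r / lossBound L ρ) hrB
    have k2 := key (-(r / lossBound L ρ)) (by rw [abs_neg, hrB])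
    have fin : ∀ y : ℝ, r / lossBound L ρ * y ≤ 2 * r ^ 2 → y ≤ 4 * lossBound L ρ * r := by
      intro y hy
      rw [div_mul_eq_mul_div, div_le_iff₀ hB] at hy
      have : r * y ≤ r * (4 * lossBound L ρ * r) := by nlinarith [mul_pos hB (pow_pos hr 2)]
      exact le_of_mul_le_mul_left this hr
    rw [abs_le]
    constructor
    · linarith [fin (-(empRisk l p z T i - risk P l (fun f => f i))) (by linarith)]
    · exact fin _ k1
  -- Here the claimed bound exceeds `B`, the range of the losses.
  · have h1 : empRisk l p z T i ∈ Set.Icc 0 (lossBound L ρ) := by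
      have := jointEmpRisk_mem_Icc (p := p) hX hz T i i i
      rwa [jointEmpRisk, jointRounds_self, jointCount_self] at this
    have h2 : risk P l (fun f => f i) ∈ Set.Icc 0 (lossBound L ρ) := by
      have hae : ∀ᵐ w ∂P, l (w.1 i) w.2 ∈ Set.Icc 0 (lossBound L ρ) :=
        hX.ae_mem.mono fun w hw => hX.mem_Icc _ (hw i) _
      refine ⟨integral_nonneg_of_ae (hae.mono fun w hw => hw.1), ?_⟩
      calc risk P l (fun f => f i) ≤ ∫ _, lossBound L ρ ∂P :=
            integral_mono_ae (hX.integrable_loss i) (integrable_const _)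
              (hae.mono fun w hw => hw.2)
        _ = lossBound L ρ := by simp
    have h3 : lossBound L ρ ≤
        4 * lossBound L ρ * Real.sqrt (x / (count p T i : ℝ)) := by nlinarith
    rw [abs_le]
    constructor <;> linarith [h1.1, h1.2, h2.1, h2.2]

end Deterministic

/-! ### Fast and slow rates, and their combination. -/

section Conclusion

variable {d K : ℕ} {𝒴 : Type*} [MeasurableSpace 𝒴] {X : Set (EuclideanSpace ℝ (Fin d))}
  {l : EuclideanSpace ℝ (Fin d) → 𝒴 → ℝ} {L ρ δ : ℝ} {P : Measure (Round d K 𝒴)}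
  {p : ℕ → Fin K × Fin K} {z : ℕ → Round d K 𝒴} {T : ℕ}

theorem log_deltaRound_le (hK : 1 ≤ K) (hT : 2 ≤ T) (hδ : 0 < δ) (hδ1 : δ < 1) :
    Real.log (4 * K * (deltaRound δ T)⁻¹) ≤ 5 * Real.log (T * K * δ⁻¹) := by
  have hK' : (1 : ℝ) ≤ K := by exact_mod_cast hK
  have hT' : (2 : ℝ) ≤ T := by exact_mod_cast hT
  have hδ' : 1 ≤ δ⁻¹ := (one_le_inv₀ hδ).2 hδ1.le
  have hw : (T : ℝ) ≤ T * K * δ⁻¹ := by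
    rw [mul_assoc]
    exact le_mul_of_one_le_right (by linarith) (one_le_mul_of_one_le_of_one_le hK' hδ')
  have h1 : 4 * ((T : ℝ) + 1) ≤ (T * K * δ⁻¹) ^ 4 := by
    calc 4 * ((T : ℝ) + 1) ≤ (T : ℝ) ^ 4 := by
          have h2 : (4 : ℝ) ≤ (T : ℝ) ^ 2 := by nlinarith
          have h3 : (T : ℝ) + 1 ≤ (T : ℝ) ^ 2 := by nlinarith
          calc 4 * ((T : ℝ) + 1) ≤ (T : ℝ) ^ 2 * (T : ℝ) ^ 2 := by gcongr
            _ = _ := by ring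
      _ ≤ _ := by gcongr
  have h5 : 4 * K * (deltaRound δ T)⁻¹ = 4 * ((T : ℝ) + 1) * (T * K * δ⁻¹) := by
    unfold deltaRound
    rw [inv_div]
    ring
  rw [h5, ← Real.log_rpow (by positivity)]
  have hpos : (0 : ℝ) < T * K * δ⁻¹ := by positivity
  refine Real.log_le_log (by positivity) ?_
  calc 4 * ((T : ℝ) + 1) * (T * K * δ⁻¹) ≤ (T * K * δ⁻¹) ^ 4 * (T * K * δ⁻¹) := by gcongr
    _ = _ := by norm_num; ring

/-- AM-GM with `L² = ρ² B / 8`. The coefficient `ρ² / 88` is what the strong convexity gain can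
absorb in the midpoint bound. -/
theorem width_le (hX : Setting X l L ρ P) {t : ℕ} {i j : Fin K} {v a : ℝ}
    (hv : empDist p z t i j ^ 2 ≤ v) (ha : alpha p t i j (deltaRound δ t) ^ 2 ≤ a) :
    11 * width L ρ δ p z t i j ≤ ρ ^ 2 / 88 * v + 350 * lossBound L ρ * a := by
  have hL := hX.L_pos
  have hρ := hX.ρ_pos
  have hB := lossBound_pos hL hρ
  have h0 := empDist_nonneg (p := p) (z := z) t i j
  have h1 := alpha_nonneg (p := p) t i j (deltaRound δ t)
  rw [width]
  set q := empDist p z t i j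
  set b := alpha p t i j (deltaRound δ t)
  have hLB : L ^ 2 = ρ ^ 2 * lossBound L ρ / 8 := by unfold lossBound; field_simp
  have hamgm : 11 * (L * b * q) ≤ ρ ^ 2 / 88 * q ^ 2 + 333 * lossBound L ρ * b ^ 2 := by
    have h2 : 0 ≤ (ρ ^ 2 / 44 * q - 11 * (L * b)) ^ 2 := sq_nonneg _
    have h3 : 0 ≤ ρ ^ 2 * (ρ ^ 2 / 88 * q ^ 2 + 333 * lossBound L ρ * b ^ 2 -
        11 * (L * b * q)) := by
      have h4 : (L * b) ^ 2 = ρ ^ 2 * (lossBound L ρ * b ^ 2) / 8 := by rw [mul_pow, hLB]; ring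
      have h5 : 0 ≤ ρ ^ 2 * (lossBound L ρ * b ^ 2) := by positivity
      nlinarith
    exact sub_nonneg.1 (nonneg_of_mul_nonneg_right h3 (by positivity))
  have hmax : max (L * b * q) (lossBound L ρ * b ^ 2) ≤ L * b * q + lossBound L ρ * b ^ 2 :=
    max_le_add_of_nonneg (by positivity) (by positivity)
  calc _ ≤ 11 * (L * b * q + lossBound L ρ * b ^ 2) := by gcongr
    _ ≤ ρ ^ 2 / 88 * q ^ 2 + 350 * lossBound L ρ * b ^ 2 := by
      nlinarith [mul_nonneg hB.le (sq_nonneg b)]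
    _ ≤ _ := by gcongr

/-- The midpoint of two distinct selected experts has a fast excess risk. -/
theorem risk_midpoint_sub_le [IsProbabilityMeasure P] (hX : Setting X l L ρ P)
    (hz : ∀ s i, (z s).1 i ∈ X) (hK : 1 ≤ K) (hδ : 0 < δ) (hδ1 : δ < 1) (hT : 2 * K ^ 2 ≤ T)
    (hrun : IsRun l L ρ δ p z) (hE : LossDiffEvent P l L ρ δ T p z)
    (hE' : SqDistEvent P L ρ (3 * Real.log (T * K * δ⁻¹)) T p z) {i k m q : Fin K}
    (hi : i ∈ survivors l L ρ δ p z T) (hsel : IsSelection l L ρ δ p z T k m q) (hkm : k ≠ m) :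
    risk P l (fun f => (1 / 2 : ℝ) • (f k + f m)) ≤ risk P l (fun f => f i) +
      4000 * lossBound L ρ * (Real.log (T * K * δ⁻¹) / (jointCount p T k m : ℝ)) := by
  have hL := hX.L_pos
  have hρ := hX.ρ_pos
  have hB := lossBound_pos hL hρ
  have hK2 : 1 ≤ K ^ 2 := Nat.one_le_pow _ _ hK
  have hKT : K ^ 2 < T := by omega
  have hT0 : 0 < T := by omega
  have hnkm := jointCount_pos hrun hKT hsel.k_mem hsel.m_mem
  have hnik := jointCount_pos hrun hKT hi hsel.k_mem
  have hnim := jointCount_pos hrun hKT hi hsel.m_mem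
  have hck := jointCount_le_add_one hrun hkm.symm T hi
  have hcm := jointCount_le_add_one hrun hkm T hi
  rw [jointCount_comm] at hck
  have hck' : (jointCount p T k m : ℝ) ≤ 2 * jointCount p T i k := by
    exact_mod_cast (by omega : jointCount p T k m ≤ 2 * jointCount p T i k)
  have hcm' : (jointCount p T k m : ℝ) ≤ 2 * jointCount p T i m := by
    exact_mod_cast (by omega : jointCount p T k m ≤ 2 * jointCount p T i m)
  have hnkm' : (0 : ℝ) < jointCount p T k m := by exact_mod_cast hnkm
  have hnik' : (0 : ℝ) < jointCount p T i k := by exact_mod_cast hnik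
  have hnim' : (0 : ℝ) < jointCount p T i m := by exact_mod_cast hnim
  have hlog := log_deltaRound_le hK (by omega : 2 ≤ T) hδ hδ1
  have hrk := hE.risk_sub_le hX hz hK hδ hδ1 hT0 hsel.k_mem hnik
  have hrm := hE.risk_sub_le hX hz hK hδ hδ1 hT0 hsel.m_mem hnim
  obtain ⟨t, rfl⟩ := Nat.exists_eq_succ_of_ne_zero hT0.ne'
  simp only [Nat.succ_eq_add_one] at *
  have hlog1 := one_le_log_deltaRound hK hδ hδ1 t
  set Λ := Real.log (((t + 1 : ℕ) : ℝ) * K * δ⁻¹)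
  set n : ℝ := (jointCount p (t + 1) k m : ℝ)
  have hΛ : 0 < Λ := by linarith
  have hdiv : ∀ {c N : ℝ}, 0 < N → 0 ≤ c → n ≤ 2 * N → c * Λ / N ≤ 2 * c * (Λ / n) := by
    intro c N hN hc hnN
    rw [mul_div_assoc', div_le_div_iff₀ hN hnkm']
    nlinarith [mul_le_mul_of_nonneg_left hnN (mul_nonneg hc hΛ.le)]
  have hak : alpha p (t + 1) i k (deltaRound δ (t + 1)) ^ 2 ≤ 10 * (Λ / n) := by
    rw [alpha_sq hK hδ hδ1]
    calc _ ≤ 5 * Λ / (jointCount p (t + 1) i k : ℝ) := by gcongr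
      _ ≤ _ := hdiv hnik' (by norm_num) hck'
      _ = _ := by norm_num
  have ham : alpha p (t + 1) i m (deltaRound δ (t + 1)) ^ 2 ≤ 10 * (Λ / n) := by
    rw [alpha_sq hK hδ hδ1]
    calc _ ≤ 5 * Λ / (jointCount p (t + 1) i m : ℝ) := by gcongr
      _ ≤ _ := hdiv hnim' (by norm_num) hcm'
      _ = _ := by norm_num
  have hb := sqDiam_pos hL hρ
  set b := sqDiam L ρ
  set r := Λ / n
  have hu := hE'.empDist_sq_le hL hρ hnkm
  rw [mul_div_assoc] at hu
  -- The choice of `m` as farthest from `k` enters only here: the surviving expert `i` is no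
  -- farther.
  have huk : empDist p z (t + 1) i k ^ 2 ≤ empDist p z (t + 1) k m ^ 2 := by
    rw [empDist_comm]
    exact pow_le_pow_left₀ (empDist_nonneg _ _ _) (hsel.m_max i hi) 2
  have hsik := hE'.sqDist_le hL hρ hnik
  have hdim := hE'.empDist_sq_le hL hρ hnim
  have h6k := mul_le_mul_of_nonneg_left (hdiv hnik' (by norm_num : (0 : ℝ) ≤ 3) hck') hb.le
  have h6m := mul_le_mul_of_nonneg_left (hdiv hnim' (by norm_num : (0 : ℝ) ≤ 3) hcm') hb.le
  have htri := TwoPointFeedback.sqDist_le hX.convex hL hρ hX.ae_mem hX.loss i k m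
  have hvk : empDist p z (t + 1) i k ^ 2 ≤ 2 * sqDist P k m + 3 * (b * r) := by linarith
  -- The comparison of `i` and `m` goes from empirical to mean distance, through `k` by the triangle
  -- inequality, and back.
  have hvm : empDist p z (t + 1) i m ^ 2 ≤ 20 * sqDist P k m + 78 * (b * r) := by linarith
  have hwk := width_le (δ := δ) hX hvk hak
  have hwm := width_le (δ := δ) hX hvm ham
  have hmid := risk_midpoint_le hX.isClosed hX.convex hL hρ hX.measurable_loss hX.loss
    hX.mem_Icc hX.ae_mem k m
  have hbB : ρ ^ 2 * b = 2 * lossBound L ρ := by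
    simp only [b, sqDiam, lossBound]; field_simp; norm_num
  have hbB' : ρ ^ 2 / 88 * (b * r) = lossBound L ρ * r / 44 := by
    linear_combination r / 88 * hbB
  have hBr : 0 < lossBound L ρ * r := by positivity
  -- Averaging the two excess risks gives `(2 + 20) / 2 * ρ² / 88 = ρ² / 8` times `sqDist P k m`,
  -- cancelled exactly by the midpoint gain.
  linarith

/-- The expert of least empirical risk has a slow excess risk. -/
theorem risk_selected_sub_le [IsProbabilityMeasure P] (hX : Setting X l L ρ P)
    (hz : ∀ s i, (z s).1 i ∈ X) (hK : 1 ≤ K) (hδ : 0 < δ) (hδ1 : δ < 1) (hT : 2 * K ^ 2 ≤ T)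
    (hrun : IsRun l L ρ δ p z)
    (hE' : LossEvent P l L ρ (3 * Real.log (T * K * δ⁻¹)) T p z) {i k m q : Fin K}
    (hi : i ∈ survivors l L ρ δ p z T) (hsel : IsSelection l L ρ δ p z T k m q) :
    risk P l (fun f => f q) ≤ risk P l (fun f => f i) +
      4000 * lossBound L ρ * Real.sqrt (Real.log (T * K * δ⁻¹) / (count p T q : ℝ)) := by
  have hB := lossBound_pos hX.L_pos hX.ρ_pos
  have hK2 : 1 ≤ K ^ 2 := Nat.one_le_pow _ _ hK
  have hKT : K ^ 2 < T := by omega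
  have hΛ : 0 < Real.log (T * K * δ⁻¹) := by
    have h1 := log_deltaRound_le hK (by omega : 2 ≤ T) hδ hδ1
    obtain ⟨t, rfl⟩ := Nat.exists_eq_succ_of_ne_zero (by omega : T ≠ 0)
    have h2 := one_le_log_deltaRound hK hδ hδ1 t
    simp only [Nat.succ_eq_add_one] at *
    linarith
  have hnq := jointCount_pos hrun hKT hsel.q_mem hsel.q_mem
  have hni := jointCount_pos hrun hKT hi hi
  rw [jointCount_self] at hnq hni
  have h3 : count p T q ≤ 3 * count p T i := count_le_three_mul_count hrun hKT
    (fun t _ u v h => h.two_le_jointCount hX hz hK hδ hδ1) hsel.q_mem hi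
  have hq := abs_le.1 (hE'.abs_sub_le (by positivity) hX hz hnq)
  have hi' := abs_le.1 (hE'.abs_sub_le (by positivity) hX hz hni)
  have hnq' : (0 : ℝ) < count p T q := by exact_mod_cast hnq
  have hni' : (0 : ℝ) < count p T i := by exact_mod_cast hni
  have h3' : (count p T q : ℝ) ≤ 3 * count p T i := by exact_mod_cast h3
  set Λ := Real.log (T * K * δ⁻¹)
  have hr0 := Real.sqrt_nonneg (Λ / (count p T q : ℝ))
  have hscale : ∀ {N : ℝ}, 0 < N → (count p T q : ℝ) ≤ 3 * N →
      Real.sqrt (3 * Λ / N) ≤ 3 * Real.sqrt (Λ / (count p T q : ℝ)) := by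
    intro N hN h
    refine Real.sqrt_le_iff.2 ⟨by positivity, ?_⟩
    rw [mul_pow, Real.sq_sqrt (by positivity), mul_div_assoc', div_le_div_iff₀ hN hnq']
    nlinarith [mul_le_mul_of_nonneg_left h hΛ.le]
  have h1 := mul_le_mul_of_nonneg_left (hscale hnq' (by linarith)) hB.le
  have h2 := mul_le_mul_of_nonneg_left (hscale hni' h3') hB.le
  have h4 := hsel.q_min i hi
  have h5 := mul_nonneg hB.le hr0
  linarith

theorem risk_output_le [IsProbabilityMeasure P] (hX : Setting X l L ρ P)
    (hz : ∀ s i, (z s).1 i ∈ X) (hK : 1 ≤ K) (hδ : 0 < δ) (hδ1 : δ < 1) (hT : 2 * K ^ 2 ≤ T)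
    (hrun : IsRun l L ρ δ p z) (hE1 : LossDiffEvent P l L ρ δ T p z)
    (hE2 : SqDistEvent P L ρ (3 * Real.log (T * K * δ⁻¹)) T p z)
    (hE3 : LossEvent P l L ρ (3 * Real.log (T * K * δ⁻¹)) T p z) :
    (survivors l L ρ δ p z T).Nonempty ∧ ∀ k m q : Fin K, IsSelection l L ρ δ p z T k m q →
      risk P l (output δ p T k m q) ≤ bestRisk P l + 4000 * lossBound L ρ *
        min (Real.log (T * K * δ⁻¹) / (jointCount p T k m : ℝ))
          (Real.sqrt (Real.log (T * K * δ⁻¹) / (count p T q : ℝ))) := by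
  have hB := lossBound_pos hX.L_pos hX.ρ_pos
  have : Nonempty (Fin K) := ⟨⟨0, hK⟩⟩
  obtain ⟨i, hi⟩ := exists_eq_ciInf_of_finite (f := fun i : Fin K => risk P l (fun f => f i))
  have hbest : ∀ j, risk P l (fun f => f i) ≤ risk P l (fun f => f j) := fun j =>
    hi.trans_le (ciInf_le (Set.finite_range _).bddBelow j)
  have hmem := hE1.best_mem_survivors hX hz hK hδ hδ1 hbest le_rfl
  refine ⟨⟨i, hmem⟩, fun k m q hsel => ?_⟩
  rw [show bestRisk P l = risk P l (fun f => f i) from hi.symm]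
  have hK2 : 1 ≤ K ^ 2 := Nat.one_le_pow _ _ hK
  have hKT : K ^ 2 < T := by omega
  have hlog : Real.log ((K : ℝ) * T * δ⁻¹) = Real.log (T * K * δ⁻¹) := by
    rw [mul_comm (K : ℝ)]
  have hΛ : 0 ≤ Real.log (T * K * δ⁻¹) := by
    refine Real.log_nonneg (one_le_mul_of_one_le_of_one_le ?_ ((one_le_inv₀ hδ).2 hδ1.le))
    exact_mod_cast Nat.one_le_iff_ne_zero.2 (Nat.mul_ne_zero (by omega) (by omega))
  have hnq := jointCount_pos hrun hKT hsel.q_mem hsel.q_mem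
  have hnkm := jointCount_pos hrun hKT hsel.k_mem hsel.m_mem
  rw [jointCount_self] at hnq
  have hnq' : (0 : ℝ) < count p T q := by exact_mod_cast hnq
  have hnkm' : (0 : ℝ) < jointCount p T k m := by exact_mod_cast hnkm
  -- Hence comparing `T_km` with its threshold in `output` amounts to comparing the fast bound with
  -- the slow one.
  have hmul : Real.sqrt (Real.log (T * K * δ⁻¹) * count p T q) *
      Real.sqrt (Real.log (T * K * δ⁻¹) / count p T q) = Real.log (T * K * δ⁻¹) := by
    rw [← Real.sqrt_mul (by positivity),
      show Real.log (T * K * δ⁻¹) * count p T q * (Real.log (T * K * δ⁻¹) / count p T q) =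
        Real.log (T * K * δ⁻¹) ^ 2 by field_simp, Real.sqrt_sq hΛ]
  have hr0 := Real.sqrt_nonneg (Real.log (T * K * δ⁻¹) / (count p T q : ℝ))
  unfold output
  rw [hlog]
  split_ifs with hcond
  · rcases eq_or_ne k m with rfl | hkm
    -- Equal selected experts mean a single survivor, which is the best expert, so the excess risk
    -- vanishes.
    · have hS : survivors l L ρ δ p z T = {k} := by
        by_contra h
        exact hsel.m_ne h rfl
      rw [hS, Finset.mem_singleton] at hmem
      subst hmem
      have h1 : (fun f : Fin K → EuclideanSpace ℝ (Fin d) => (1 / 2 : ℝ) • (f i + f i)) =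
          fun f => f i := by
        funext f
        rw [← two_smul ℝ, smul_smul]
        norm_num
      rw [h1]
      exact le_add_of_nonneg_right (mul_nonneg (by positivity)
        (le_min (by positivity) (by positivity)))
    · rw [min_eq_left]
      · exact risk_midpoint_sub_le hX hz hK hδ hδ1 hT hrun hE1 hE2 hmem hsel hkm
      · rw [div_le_iff₀ hnkm']
        nlinarith
  · rw [min_eq_right]
    · exact risk_selected_sub_le hX hz hK hδ hδ1 hT hrun hE3 hmem hsel
    · rw [le_div_iff₀ hnkm']
      nlinarith

end Conclusion

/-- Level 3 log makes each tail `(δ / (T K))³`, enough for a union over `K²` pairs, or over `K T`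
experts and counts, with two tails each. -/
theorem two_mul_mul_exp_neg_le {n T K δ : ℝ} (hT : 2 ≤ T) (hK : 1 ≤ K) (hδ : 0 < δ)
    (hδ1 : δ < 1) (hn : n ≤ (T * K) ^ 2) :
    2 * n * Real.exp (-(3 * Real.log (T * K * δ⁻¹))) ≤ δ := by
  have hpos : 0 < T * K := by positivity
  have he : Real.exp (-(3 * Real.log (T * K * δ⁻¹))) = (δ / (T * K)) ^ 3 := by
    rw [← Real.log_rpow (by positivity), ← Real.log_inv, Real.exp_log (by positivity)]
    norm_num
    field_simp
  have h2 : 2 ≤ T * K := hT.trans (le_mul_of_one_le_right (by linarith) hK)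
  rw [he]
  calc 2 * n * (δ / (T * K)) ^ 3 ≤ 2 * (T * K) ^ 2 * (δ / (T * K)) ^ 3 := by gcongr
    _ = 2 / (T * K) * δ ^ 3 := by field_simp
    _ ≤ 1 * δ ^ 3 := by gcongr; exact (div_le_one hpos).2 h2
    _ ≤ δ := by nlinarith [mul_pos hδ hδ, mul_pos (mul_pos hδ hδ) hδ]

end TwoPointFeedback

/-- Empirical bound for the two-point feedback algorithm. `Z s` and `p s` are the data of, and the
pair of experts queried in, round `s + 1`; `ℱ t` is the information available after `t` rounds,
which may contain external randomization used to break ties. Since `Z t` is `ℱ (t + 1)`-measurable,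
independent of `ℱ t` and of law `P`, the rounds are i.i.d. -/
theorem mainTheorem2 :
    ∃ c : ℝ, 0 < c ∧
      ∀ (d K : ℕ), 1 ≤ K →
      ∀ (𝒴 : Type*) [MeasurableSpace 𝒴]
        (X : Set (EuclideanSpace ℝ (Fin d))), IsClosed X → Convex ℝ X →
      ∀ (l : EuclideanSpace ℝ (Fin d) → 𝒴 → ℝ) (L ρ : ℝ), 0 < L → 0 < ρ →
        (∀ x ∈ X, Measurable (l x)) →
        TwoPointFeedback.LossAssumption X l L ρ →
        (∀ x ∈ X, ∀ y, l x y ∈ Set.Icc 0 (TwoPointFeedback.lossBound L ρ)) →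
      ∀ (P : Measure (TwoPointFeedback.Round d K 𝒴)) [IsProbabilityMeasure P],
        (∀ᵐ z ∂P, ∀ i, z.1 i ∈ X) →
      ∀ (Ω : Type*) [mΩ : MeasurableSpace Ω] (μ : Measure Ω) [IsProbabilityMeasure μ]
        (ℱ : Filtration ℕ mΩ)
        (Z : ℕ → Ω → TwoPointFeedback.Round d K 𝒴) (p : ℕ → Ω → Fin K × Fin K),
        (∀ t, Measurable[ℱ (t + 1)] (Z t)) →
        (∀ t, Measure.map (Z t) μ = P) →
        (∀ t, Indep (MeasurableSpace.comap (Z t) inferInstance) (ℱ t) μ) →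
        (∀ t, Measurable[ℱ t] (p t)) →
      ∀ (δ : ℝ), 0 < δ → δ < 1 →
        (∀ᵐ ω ∂μ, TwoPointFeedback.IsRun l L ρ δ (fun s => p s ω) (fun s => Z s ω)) →
      ∀ (T : ℕ), 2 * K ^ 2 ≤ T →
        ENNReal.ofReal (1 - 3 * δ) ≤ μ {ω |
          (TwoPointFeedback.survivors l L ρ δ (fun s => p s ω) (fun s => Z s ω) T).Nonempty ∧
          ∀ k m q : Fin K,
            TwoPointFeedback.IsSelection l L ρ δ (fun s => p s ω) (fun s => Z s ω) T k m q →
            TwoPointFeedback.risk P l (TwoPointFeedback.output δ (fun s => p s ω) T k m q) ≤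
              TwoPointFeedback.bestRisk P l +
                c * TwoPointFeedback.lossBound L ρ *
                  min
                    (Real.log ((T : ℝ) * (K : ℝ) * δ⁻¹) /
                      (TwoPointFeedback.jointCount (fun s => p s ω) T k m : ℝ))
                    (Real.sqrt (Real.log ((T : ℝ) * (K : ℝ) * δ⁻¹) /
                      (TwoPointFeedback.count (fun s => p s ω) T q : ℝ)))} := by
  refine ⟨4000, by norm_num, ?_⟩
  intro d K hK 𝒴 _ X hXc hXconv l L ρ hL hρ hmeas hloss hIcc P _ hPX Ω mΩ μ _ ℱ Z p hZ hmap hind hp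
    δ hδ hδ1 hrun T hT
  have hX : TwoPointFeedback.Setting X l L ρ P := ⟨hXc, hXconv, hL, hρ, hmeas, hloss, hIcc, hPX⟩
  have hS : TwoPointFeedback.Sampling P μ ℱ Z p := ⟨hZ, hmap, hind, hp⟩
  have hK2 : 1 ≤ K ^ 2 := Nat.one_le_pow _ _ hK
  have hT2 : (2 : ℝ) ≤ T := by exact_mod_cast (by omega : 2 ≤ T)
  have hK' : (1 : ℝ) ≤ K := by exact_mod_cast hK
  have hgood : ∀ᵐ ω ∂μ, ∀ s i, (Z s ω).1 i ∈ X := by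
    refine ae_all_iff.2 fun s => ?_
    rw [← hmap s] at hPX
    exact ae_of_ae_map ((hZ s).mono (ℱ.le _) le_rfl).aemeasurable hPX
  have h1 := hX.measure_not_lossDiffEvent_le hS hK hδ hδ1 T
  have h2 := (hX.measure_not_sqDistEvent_le hS (T := T) (3 * Real.log (T * K * δ⁻¹))).trans
    (ENNReal.ofReal_le_ofReal (TwoPointFeedback.two_mul_mul_exp_neg_le (n := (K : ℝ) ^ 2)
      hT2 hK' hδ hδ1 (pow_le_pow_left₀ (by linarith)
        (le_mul_of_one_le_left (by linarith) (by linarith)) 2)))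
  have h3 := (hX.measure_not_lossEvent_le hS (T := T) (3 * Real.log (T * K * δ⁻¹))).trans
    (ENNReal.ofReal_le_ofReal (TwoPointFeedback.two_mul_mul_exp_neg_le (n := (K : ℝ) * T)
      hT2 hK' hδ hδ1 (by rw [mul_comm (K : ℝ)]; exact le_self_pow₀ (by nlinarith) two_ne_zero)))
  have hae := ae_iff.1 (hgood.and hrun)
  set bad := {ω | ¬((∀ s i, (Z s ω).1 i ∈ X) ∧
    TwoPointFeedback.IsRun l L ρ δ (fun s => p s ω) (fun s => Z s ω))}
  set bad₁ := {ω | ¬ TwoPointFeedback.LossDiffEvent P l L ρ δ T (fun s => p s ω) (fun s => Z s ω)}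
  set bad₂ := {ω | ¬ TwoPointFeedback.SqDistEvent P L ρ (3 * Real.log (T * K * δ⁻¹)) T
    (fun s => p s ω) (fun s => Z s ω)}
  set bad₃ := {ω | ¬ TwoPointFeedback.LossEvent P l L ρ (3 * Real.log (T * K * δ⁻¹)) T
    (fun s => p s ω) (fun s => Z s ω)}
  have hbad : μ (bad ∪ (bad₁ ∪ (bad₂ ∪ bad₃))) ≤ ENNReal.ofReal (3 * δ) := by
    rw [show 3 * δ = δ + (δ + δ) by ring, ENNReal.ofReal_add hδ.le (by linarith),
      ENNReal.ofReal_add hδ.le hδ.le]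
    calc _ ≤ μ bad + (μ bad₁ + (μ bad₂ + μ bad₃)) :=
          (measure_union_le _ _).trans (add_le_add le_rfl ((measure_union_le _ _).trans
            (add_le_add le_rfl (measure_union_le _ _))))
      _ ≤ _ := by
          rw [hae, zero_add]
          exact add_le_add h1 (add_le_add h2 h3)
  rw [ENNReal.ofReal_sub _ (by positivity), ENNReal.ofReal_one, tsub_le_iff_right]
  refine le_trans ?_ (add_le_add le_rfl hbad)
  rw [← measure_univ (μ := μ)]
  -- Covering `Ω` by the target event and the bad sets requires no measurability of either.
  refine (measure_mono fun ω _ => ?_).trans (measure_union_le _ _)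
  by_cases hω : ω ∈ bad ∪ (bad₁ ∪ (bad₂ ∪ bad₃))
  · exact Or.inr hω
  · simp only [bad, bad₁, bad₂, bad₃, Set.mem_union, Set.mem_ofPred_eq, not_or, not_not] at hω
    obtain ⟨⟨hz, hr⟩, hE1, hE2, hE3⟩ := hω
    exact Or.inl (TwoPointFeedback.risk_output_le hX hz hK hδ hδ1 hT hr hE1 hE2 hE3)
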